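/- Let $0<\alpha<1$, $0<\beta<1$, $0<\gamma\le 1$ with $\alpha+\beta+\gamma>2$, and put $a=\frac{\alpha+\beta-\gamma}{2}$, $b=\frac{\alpha+\beta+\gamma-2}{2}$, $c=\alpha$. Let $F(a,b,c;z)$ be the principal branch of the Gauss hypergeometric function, i.e. the analytic continuation of $\sum_{n\ge0}\frac{(a)_n(b)_n}{(c)_n}\frac{z^n}{n!}$ to $\mathbb C\setminus[1,+\infty)$, given on the cut by its boundary values from the lower half-plane. Let $\varphi_1(z)=F(a,b,c;z)$, $\varphi_2(z)=F(a,b,a+b-c+1;1-z)$, $$K_1=-\frac{\Gamma(c-a)\Gamma(c-b)}{\Gamma(c)\Gamma(c-a-b)},\qquad K_2=-\frac{\Gamma(a+1-c)\Gamma(b+1-c)}{\Gamma(1-c)\Gamma(a+b+1-c)},$$ $$K_3=\sqrt{\frac{\sin(\pi a)\sin(\pi b)}{\sin(\pi(c-a))\sin(\pi(c-b))}}\cdot\frac{\Gamma(a+b+1-c)\Gamma(c)}{\Gamma(a)\Gamma(b)},$$ $$\delta=\frac{\Gamma(c)}{\Gamma(2-c)}\left(\frac{\Gamma(1-a)\Gamma(1-b)\Gamma(a+1-c)\Gamma(b+1-c)}{\Gamma(a)\Gamma(b)\Gamma(c-a)\Gamma(c-b)}\right)^{1/2},$$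 and let $$\lambda(z)=\lambda_{\alpha,\beta,\gamma}(z)=\frac{1}{|z|^{\alpha}|1-z|^{\beta}}\cdot\frac{K_3}{K_1|\varphi_1(z)|^2+K_2|\varphi_2(z)|^2+2\,\mathrm{Re}\,(\varphi_1(z)\varphi_2(\bar z))}$$ be the generalized hyperbolic density of curvature $-4$ on the sphere with conical singularities of orders $\alpha,\beta,\gamma$ at $0,1,\infty$. Write $\partial=\partial/\partial z$ and $\bar\partial=\partial/\partial\bar z$. Then $\lambda$ is $C^\infty$ in a punctured neighbourhood of $0$, and for all integers $m,n\ge 0$ the limit $$l_{m,n}:=\frac{1}{m!\,n!}\lim_{z\to0}|z|^{\alpha}\,\bar z^{\,m}z^{n}\,\bar\partial^{m}\partial^{n}\lambda(z)$$ exists. With $$l:=l_{0,0}=\lim_{z\to0}|z|^\alpha\lambda(z)=\delta(1-\alpha),$$ these numbers satisfy, for all $m,n\ge0$, (i) $\displaystyle l_{m,n}=\binom{-\alpha/2}{n}\binom{-\alpha/2}{m}\,l$, (ii) $l_{m,n}=l_{n,m}$, where $\binom{\tau}{j}=\frac{\tau(\tau-1)\cdots(\tau-j+1)}{j!}$. 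-/

import Mathlib

open Filter Topology
open scoped ContDiff Nat ComplexConjugate

noncomputable section

namespace ThreeCone

/-- The plane slit along `[1, +∞)`. -/
def slitAtOne : Set ℂ := {z | 1 - z ∈ Complex.slitPlane}

/-- `f` is the analytic continuation to `ℂ \ [1, +∞)` of the Gauss series `∑ (a)ₙ(b)ₙ/(c)ₙ zⁿ/n!`,
which converges in the unit disc. -/
def IsGaussContinuation (a b c : ℂ) (f : ℂ → ℂ) : Prop :=
  DifferentiableOn ℂ f slitAtOne ∧
    ∀ z : ℂ, ‖z‖ < 1 → f z = ordinaryHypergeometric a b c z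

open Classical in
/-- The analytic continuation of the Gauss series to `ℂ \ [1, +∞)`. It is unique on that connected
domain; only its values there are used. -/
def gaussContinuation (a b c : ℂ) : ℂ → ℂ :=
  if h : ∃ f, IsGaussContinuation a b c f then h.choose else 0

open Classical in
/-- The Gauss hypergeometric function `F(a, b, c; z)`, principal branch: the analytic continuation
on `ℂ \ [1, +∞)`, and on the cut `[1, +∞)` the boundary value from the lower half plane
(which corresponds to the usual convention `arg (1 - z) = π` there). -/
def F (a b c z : ℂ) : ℂ :=
  if z ∈ slitAtOne then gaussContinuation a b c z
  else limUnder (𝓝[{w : ℂ | w.im < 0}] z) (gaussContinuation a b c)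

/-- The parameter `a = (α + β - γ) / 2`. -/
def parA (α β γ : ℝ) : ℝ := (α + β - γ) / 2

/-- The parameter `b = (α + β + γ - 2) / 2`. -/
def parB (α β γ : ℝ) : ℝ := (α + β + γ - 2) / 2

/-- The function `φ₁(z) = F(a, b, c; z)` with `c = α`. -/
def phi₁ (α β γ : ℝ) (z : ℂ) : ℂ :=
  F (parA α β γ) (parB α β γ) α z

/-- The function `φ₂(z) = F(a, b, a + b - c + 1; 1 - z)` with `c = α`. -/
def phi₂ (α β γ : ℝ) (z : ℂ) : ℂ :=
  F (parA α β γ) (parB α β γ) (parA α β γ + parB α β γ - α + 1) (1 - z)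

/-- `K₁ = - Γ(c-a) Γ(c-b) / (Γ(c) Γ(c-a-b))`. -/
def K₁ (α β γ : ℝ) : ℝ :=
  let a := parA α β γ
  let b := parB α β γ
  let c := α;
  -(Real.Gamma (c - a) * Real.Gamma (c - b) / (Real.Gamma c * Real.Gamma (c - a - b)))

/-- `K₂ = - Γ(a+1-c) Γ(b+1-c) / (Γ(1-c) Γ(a+b+1-c))`. -/
def K₂ (α β γ : ℝ) : ℝ :=
  let a := parA α β γ
  let b := parB α β γ
  let c := α;
  -(Real.Gamma (a + 1 - c) * Real.Gamma (b + 1 - c) /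
    (Real.Gamma (1 - c) * Real.Gamma (a + b + 1 - c)))

/-- `K₃ = √(sin πa sin πb / (sin π(c-a) sin π(c-b))) · Γ(a+b+1-c) Γ(c) / (Γ(a) Γ(b))`. -/
def K₃ (α β γ : ℝ) : ℝ :=
  let a := parA α β γ
  let b := parB α β γ
  let c := α
  Real.sqrt (Real.sin (Real.pi * a) * Real.sin (Real.pi * b) /
      (Real.sin (Real.pi * (c - a)) * Real.sin (Real.pi * (c - b)))) *
    (Real.Gamma (a + b + 1 - c) * Real.Gamma c / (Real.Gamma a * Real.Gamma b))

/-- The constant `δ`. -/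
def delta (α β γ : ℝ) : ℝ :=
  let a := parA α β γ
  let b := parB α β γ
  let c := α
  Real.Gamma c / Real.Gamma (2 - c) *
    Real.sqrt ((Real.Gamma (1 - a) * Real.Gamma (1 - b) * Real.Gamma (a + 1 - c) *
        Real.Gamma (b + 1 - c)) /
      (Real.Gamma a * Real.Gamma b * Real.Gamma (c - a) * Real.Gamma (c - b)))

/-- The generalized hyperbolic density `λ_{α,β,γ}` of curvature `-4` on the sphere with conical
singularities of orders `α, β, γ` at `0, 1, ∞`, by its explicit formula on `ℂ \ {0, 1}`. -/
def density (α β γ : ℝ) (z : ℂ) : ℝ :=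
  1 / (‖z‖ ^ α * ‖1 - z‖ ^ β) *
    (K₃ α β γ /
      (K₁ α β γ * ‖phi₁ α β γ z‖ ^ 2 + K₂ α β γ * ‖phi₂ α β γ z‖ ^ 2 +
        2 * (phi₁ α β γ z * phi₂ α β γ (conj z)).re))

/-- The Wirtinger derivative `∂ = ∂/∂z = (∂/∂x - i ∂/∂y) / 2`. -/
def dz (f : ℂ → ℂ) (z : ℂ) : ℂ :=
  (fderiv ℝ f z 1 - Complex.I * fderiv ℝ f z Complex.I) / 2

/-- The Wirtinger derivative `∂̄ = ∂/∂z̄ = (∂/∂x + i ∂/∂y) / 2`. -/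
def dzbar (f : ℂ → ℂ) (z : ℂ) : ℂ :=
  (fderiv ℝ f z 1 + Complex.I * fderiv ℝ f z Complex.I) / 2

/-- The binomial coefficient `τ (τ - 1) ⋯ (τ - j + 1) / j!`. -/
def binom (τ : ℝ) (j : ℕ) : ℝ :=
  (∏ i ∈ Finset.range j, (τ - i)) / (j ! : ℝ)

end ThreeCone

end

noncomputable section

namespace ThreeCone

/-! ### Wirtinger calculus -/

/-! Near the origin the density is `|z|^(-α) g(z)`, where `g` has a nonzero limit in the formulas
but need not be smooth at `0`: it contains a term in `|z|^(2(1-α))`. What survives is that the Euler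
operators `z∂` and `z̄∂̄`, applied any positive number of times, send `g` to functions tending to
`0`. This is `Tame`, a class closed under sums, products and inverses (for a nonzero limit) that
contains the functions smooth at `0` and `|z|^s` with `s > 0`. For tame `g`, each `∂` or `∂̄`
applied to `|z|^s g` asymptotically acts on the power alone, so falling factorials of `s/2` appear
(`tendsto_iterate_absPow_mul`); the theorem is the case `s = -α`.

To reach this form, `exists_connection` gives `φ₂ = A φ₁ + z^(1-c) H` with `H` analytic at `0`.
Since `K₂ = -1/A`, the cross terms cancel and the denominator becomes `(K₁ + A)|φ₁|² - A⁻¹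
|z|^(2(1-c)) |H|²`. The Gamma reflection formula evaluates `K₁ + A` (`neg_add_connCoeff`) and
identifies the limit with `δ(1-α)` (`K₃_div_eq`).

The connection formula comes from Abel's identity for the Wronskian and reduction of order
(`exists_eq_add_cpow_mul`). The constant `A` is read off as `z → 0` along the positive reals, by
Gauss's summation theorem, which follows from Euler's integral; `H` is never needed explicitly.
Euler's integral also supplies the continuation of the Gauss series to the slit plane and its
symmetry under conjugation. -/

/-- The real-linear map `h ↦ p h + q h̄`. -/
def wirtinger (p q : ℂ) : ℂ →L[ℝ] ℂ :=
  p • (ContinuousLinearMap.id ℝ ℂ) + q • (Complex.conjCLE : ℂ →L[ℝ] ℂ)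

@[simp] lemma wirtinger_apply (p q h : ℂ) : wirtinger p q h = p * h + q * conj h := by
  simp [wirtinger]

/-- A real-linear map is determined by its values at `1` and `i`. Hence every real derivative is
encoded by its two Wirtinger coefficients, and the calculus rules below become rules for pairs. -/
lemma eq_wirtinger (A : ℂ →L[ℝ] ℂ) :
    A = wirtinger ((A 1 - Complex.I * A Complex.I) / 2) ((A 1 + Complex.I * A Complex.I) / 2) := by
  ext h
  have key : A h = (h.re : ℂ) * A 1 + (h.im : ℂ) * A Complex.I := by
    have : h = h.re • (1 : ℂ) + h.im • Complex.I := by simp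
    conv_lhs => rw [this]
    rw [map_add, map_smul, map_smul]; simp
  have h1 : h = h.re + h.im * Complex.I := (Complex.re_add_im h).symm
  have h2 : conj h = h.re - h.im * Complex.I := by
    apply Complex.ext <;> simp
  rw [key, wirtinger_apply, h2]
  conv_rhs => rw [h1]
  simp only [Complex.add_re, Complex.add_im, Complex.ofReal_re, Complex.ofReal_im, Complex.mul_re,
    Complex.mul_im, Complex.I_re, Complex.I_im]
  simp only [mul_zero, mul_one, sub_self, add_zero, zero_add]
  linear_combination ((h.im : ℂ) * A Complex.I) * Complex.I_sq

variable {f g : ℂ → ℂ} {z p q p' q' : ℂ}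

lemma dz_eq (h : HasFDerivAt f (wirtinger p q) z) : dz f z = p := by
  rw [dz, h.fderiv]
  simp only [wirtinger_apply, map_one, Complex.conj_I]
  linear_combination (-(p - q) / 2) * Complex.I_sq

lemma dzbar_eq (h : HasFDerivAt f (wirtinger p q) z) : dzbar f z = q := by
  rw [dzbar, h.fderiv]
  simp only [wirtinger_apply, map_one, Complex.conj_I]
  linear_combination ((p - q) / 2) * Complex.I_sq

lemma hasFDerivAt_wirtinger (h : DifferentiableAt ℝ f z) :
    HasFDerivAt f (wirtinger (dz f z) (dzbar f z)) z := by
  have := h.hasFDerivAt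
  rw [eq_wirtinger (fderiv ℝ f z)] at this
  exact this

lemma wirtinger_mul (hf : HasFDerivAt f (wirtinger p q) z)
    (hg : HasFDerivAt g (wirtinger p' q') z) :
    HasFDerivAt (fun w => f w * g w) (wirtinger (p * g z + f z * p') (q * g z + f z * q')) z := by
  refine (hf.mul hg).congr_fderiv ?_
  ext h
  simp
  ring

lemma wirtinger_add (hf : HasFDerivAt f (wirtinger p q) z)
    (hg : HasFDerivAt g (wirtinger p' q') z) :
    HasFDerivAt (fun w => f w + g w) (wirtinger (p + p') (q + q')) z := by
  refine (hf.add hg).congr_fderiv ?_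
  ext h
  simp
  ring

lemma wirtinger_of_hasDerivAt (hf : HasDerivAt f p z) : HasFDerivAt f (wirtinger p 0) z := by
  refine (hf.hasFDerivAt.restrictScalars ℝ).congr_fderiv ?_
  ext h
  simp [mul_comm]

lemma wirtinger_comp (hg : HasDerivAt g p' (f z)) (hf : HasFDerivAt f (wirtinger p q) z) :
    HasFDerivAt (fun w => g (f w)) (wirtinger (p' * p) (p' * q)) z := by
  refine ((wirtinger_of_hasDerivAt hg).comp z hf).congr_fderiv ?_
  ext h
  simp
  ring

lemma wirtinger_conj (z : ℂ) : HasFDerivAt (fun w : ℂ => conj w) (wirtinger 0 1) z := by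
  refine (Complex.conjCLE : ℂ →L[ℝ] ℂ).hasFDerivAt.congr_fderiv ?_
  ext h
  simp

/-- The complex-valued function `|z|ˢ`. -/
def absPow (s : ℝ) (z : ℂ) : ℂ := ((‖z‖ ^ s : ℝ) : ℂ)

/-- In this form the chain rule for complex powers applies, since `z z̄` is a positive real, inside
the slit plane, when `z ≠ 0`. -/
lemma absPow_eq_cpow (s : ℝ) (z : ℂ) : absPow s z = (z * conj z) ^ ((s / 2 : ℝ) : ℂ) := by
  rw [absPow, Complex.mul_conj, ← Complex.ofReal_cpow (Complex.normSq_nonneg z),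
    Complex.normSq_eq_norm_sq, ← Real.rpow_natCast, ← Real.rpow_mul (norm_nonneg z)]
  congr 2
  push_cast
  ring

lemma mul_conj_mem_slitPlane (hz : z ≠ 0) : z * conj z ∈ Complex.slitPlane := by
  rw [Complex.mul_conj]
  exact Complex.ofReal_mem_slitPlane.2 (Complex.normSq_pos.2 hz)

lemma wirtinger_absPow (s : ℝ) (hz : z ≠ 0) :
    HasFDerivAt (absPow s)
      (wirtinger ((s / 2 : ℝ) * absPow s z * z⁻¹) ((s / 2 : ℝ) * absPow s z * (conj z)⁻¹)) z := by
  have hcz : conj z ≠ 0 := (map_ne_zero _).2 hz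
  have h1 : HasFDerivAt (fun w : ℂ => w * conj w) (wirtinger (conj z) z) z := by
    simpa using wirtinger_mul (wirtinger_of_hasDerivAt (hasDerivAt_id z)) (wirtinger_conj z)
  have h2 := (hasDerivAt_id (z * conj z)).cpow_const (c := ((s / 2 : ℝ) : ℂ))
    (mul_conj_mem_slitPlane hz)
  have h3 := wirtinger_comp (f := fun w : ℂ => w * conj w) h2 h1
  have e : absPow s = fun w => (w * conj w) ^ ((s / 2 : ℝ) : ℂ) := funext (absPow_eq_cpow s)
  rw [e]
  have e1 : (z * conj z) ^ (((s / 2 : ℝ) : ℂ) - 1) =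
      (z * conj z) ^ ((s / 2 : ℝ) : ℂ) / (z * conj z) := by
    rw [Complex.cpow_sub _ _ (mul_ne_zero hz hcz), Complex.cpow_one]
  simp only [id, e1] at h3
  convert h3 using 2
  · field_simp
  · field_simp

lemma contDiffAt_absPow (s : ℝ) (hz : z ≠ 0) : ContDiffAt ℝ ∞ (absPow s) z := by
  have h1 : ContDiffAt ℝ ∞ (fun w : ℂ => ‖w‖) z := contDiffAt_id.norm ℝ hz
  exact Complex.ofRealCLM.contDiff.contDiffAt.comp z
    (h1.rpow_const_of_ne (norm_ne_zero_iff.2 hz))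

lemma contDiffAt_dz (h : ContDiffAt ℝ ∞ f z) : ContDiffAt ℝ ∞ (dz f) z := by
  have h1 : ContDiffAt ℝ ∞ (fderiv ℝ f) z := h.fderiv_right (by simp)
  unfold dz
  have h2 : ∀ v : ℂ, ContDiffAt ℝ ∞ (fun w => fderiv ℝ f w v) z :=
    fun v => h1.clm_apply contDiffAt_const
  exact ((h2 1).sub (contDiffAt_const.mul (h2 _))).div_const _

lemma contDiffAt_dzbar (h : ContDiffAt ℝ ∞ f z) : ContDiffAt ℝ ∞ (dzbar f) z := by
  have h1 : ContDiffAt ℝ ∞ (fderiv ℝ f) z := h.fderiv_right (by simp)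
  unfold dzbar
  have h2 : ∀ v : ℂ, ContDiffAt ℝ ∞ (fun w => fderiv ℝ f w v) z :=
    fun v => h1.clm_apply contDiffAt_const
  exact ((h2 1).add (contDiffAt_const.mul (h2 _))).div_const _

lemma contDiffAt_conj (z : ℂ) : ContDiffAt ℝ ∞ (fun w : ℂ => conj w) z :=
  (Complex.conjCLE : ℂ →L[ℝ] ℂ).contDiff.contDiffAt

/-! ### Functions whose Euler derivatives have limits at the origin -/

/-- The Euler operator `z ∂`. -/
def eulerOp (f : ℂ → ℂ) (z : ℂ) : ℂ := z * dz f z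

/-- The conjugate Euler operator `z̄ ∂̄`. -/
def eulerOpBar (f : ℂ → ℂ) (z : ℂ) : ℂ := conj z * dzbar f z

/-- `f` is smooth in a punctured neighbourhood of `0`, has the limit `c` at `0`, and every
nonempty word of length at most `k` in the two Euler operators sends it to a function with
limit `0`. -/
def TameOfOrder : ℕ → (ℂ → ℂ) → ℂ → Prop
  | 0, f, c => (∀ᶠ z in 𝓝[≠] (0 : ℂ), ContDiffAt ℝ ∞ f z) ∧ Tendsto f (𝓝[≠] 0) (𝓝 c)
  | k + 1, f, c => ((∀ᶠ z in 𝓝[≠] (0 : ℂ), ContDiffAt ℝ ∞ f z) ∧ Tendsto f (𝓝[≠] 0) (𝓝 c)) ∧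
      TameOfOrder k (eulerOp f) 0 ∧ TameOfOrder k (eulerOpBar f) 0

/-- `TameOfOrder` for all orders. -/
def Tame (f : ℂ → ℂ) (c : ℂ) : Prop := ∀ k, TameOfOrder k f c

lemma TameOfOrder.of_succ {k : ℕ} {c : ℂ} (h : TameOfOrder (k + 1) f c) : TameOfOrder k f c := by
  induction k generalizing f c with
  | zero => exact h.1
  | succ k ih => exact ⟨h.1, ih h.2.1, ih h.2.2⟩

/-- The punctured plane is open, so an identity near `0` holds as an identity of germs at each
nearby point and may be differentiated. -/
lemma eventually_nhds_of_punctured {P : ℂ → Prop} (h : ∀ᶠ z in 𝓝[≠] (0 : ℂ), P z) :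
    ∀ᶠ z in 𝓝[≠] (0 : ℂ), ∀ᶠ w in 𝓝 z, P w := by
  filter_upwards [eventually_eventually_nhdsWithin.2 h, self_mem_nhdsWithin] with z hz hz0
  rwa [(isOpen_compl_singleton (x := (0 : ℂ))).nhdsWithin_eq hz0] at hz

lemma dz_congr (h : f =ᶠ[𝓝 z] g) : dz f z = dz g z := by
  simp only [dz, h.fderiv_eq]

lemma dzbar_congr (h : f =ᶠ[𝓝 z] g) : dzbar f z = dzbar g z := by
  simp only [dzbar, h.fderiv_eq]

lemma dz_congr_punctured (h : f =ᶠ[𝓝[≠] 0] g) : dz f =ᶠ[𝓝[≠] 0] dz g := by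
  filter_upwards [eventually_nhds_of_punctured h] with z hz using dz_congr hz

lemma dzbar_congr_punctured (h : f =ᶠ[𝓝[≠] 0] g) : dzbar f =ᶠ[𝓝[≠] 0] dzbar g := by
  filter_upwards [eventually_nhds_of_punctured h] with z hz using dzbar_congr hz

lemma contDiffAt_congr_punctured (h : f =ᶠ[𝓝[≠] 0] g)
    (hf : ∀ᶠ z in 𝓝[≠] (0 : ℂ), ContDiffAt ℝ ∞ f z) :
    ∀ᶠ z in 𝓝[≠] (0 : ℂ), ContDiffAt ℝ ∞ g z := by
  filter_upwards [eventually_nhds_of_punctured h, hf] with z hz hfz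
  exact hfz.congr_of_eventuallyEq (hz.mono fun _ h => h.symm)

lemma TameOfOrder.congr {k : ℕ} {c : ℂ} (hf : TameOfOrder k f c) (h : f =ᶠ[𝓝[≠] 0] g) :
    TameOfOrder k g c := by
  induction k generalizing f g c with
  | zero => exact ⟨contDiffAt_congr_punctured h hf.1, hf.2.congr' h⟩
  | succ k ih =>
    refine ⟨⟨contDiffAt_congr_punctured h hf.1.1, hf.1.2.congr' h⟩, ih hf.2.1 ?_, ih hf.2.2 ?_⟩
    · filter_upwards [dz_congr_punctured h] with z hz
      simp only [eulerOp, hz]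
    · filter_upwards [dzbar_congr_punctured h] with z hz
      simp only [eulerOpBar, hz]

lemma Tame.congr {c : ℂ} (hf : Tame f c) (h : f =ᶠ[𝓝[≠] 0] g) : Tame g c :=
  fun k => (hf k).congr h

lemma Tame.eulerOp {c : ℂ} (hf : Tame f c) : Tame (eulerOp f) 0 := fun k => (hf (k + 1)).2.1

lemma Tame.eulerOpBar {c : ℂ} (hf : Tame f c) : Tame (eulerOpBar f) 0 := fun k => (hf (k + 1)).2.2

lemma Tame.contDiffAt {c : ℂ} (hf : Tame f c) : ∀ᶠ z in 𝓝[≠] (0 : ℂ), ContDiffAt ℝ ∞ f z :=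
  (hf 0).1

lemma Tame.tendsto {c : ℂ} (hf : Tame f c) : Tendsto f (𝓝[≠] 0) (𝓝 c) := (hf 0).2

lemma differentiableAt_of_contDiffAt (h : ContDiffAt ℝ ∞ f z) : DifferentiableAt ℝ f z :=
  h.differentiableAt (by simp)

lemma TameOfOrder.add {k : ℕ} {c d : ℂ} (hf : TameOfOrder k f c) (hg : TameOfOrder k g d) :
    TameOfOrder k (fun z => f z + g z) (c + d) := by
  induction k generalizing f g c d with
  | zero =>
    refine ⟨?_, hf.2.add hg.2⟩
    filter_upwards [hf.1, hg.1] with z h1 h2 using h1.add h2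
  | succ k ih =>
    refine ⟨⟨?_, hf.1.2.add hg.1.2⟩, ?_, ?_⟩
    · filter_upwards [hf.1.1, hg.1.1] with z h1 h2 using h1.add h2
    · refine (add_zero (0 : ℂ) ▸ ih hf.2.1 hg.2.1).congr ?_
      filter_upwards [hf.1.1, hg.1.1] with z h1 h2
      simp only [ThreeCone.eulerOp]
      rw [dz_eq (wirtinger_add (hasFDerivAt_wirtinger (differentiableAt_of_contDiffAt h1))
        (hasFDerivAt_wirtinger (differentiableAt_of_contDiffAt h2)))]
      ring
    · refine (add_zero (0 : ℂ) ▸ ih hf.2.2 hg.2.2).congr ?_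
      filter_upwards [hf.1.1, hg.1.1] with z h1 h2
      simp only [ThreeCone.eulerOpBar]
      rw [dzbar_eq (wirtinger_add (hasFDerivAt_wirtinger (differentiableAt_of_contDiffAt h1))
        (hasFDerivAt_wirtinger (differentiableAt_of_contDiffAt h2)))]
      ring

/-- Leibniz rule: each term of an Euler derivative has one differentiated factor, with limit `0`,
and one undifferentiated factor, whose order is lowered by `of_succ`. -/
lemma TameOfOrder.mul {k : ℕ} {c d : ℂ} (hf : TameOfOrder k f c) (hg : TameOfOrder k g d) :
    TameOfOrder k (fun z => f z * g z) (c * d) := by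
  induction k generalizing f g c d with
  | zero =>
    refine ⟨?_, hf.2.mul hg.2⟩
    filter_upwards [hf.1, hg.1] with z h1 h2 using h1.mul h2
  | succ k ih =>
    refine ⟨⟨?_, hf.1.2.mul hg.1.2⟩, ?_, ?_⟩
    · filter_upwards [hf.1.1, hg.1.1] with z h1 h2 using h1.mul h2
    · have h := (ih hf.2.1 hg.of_succ).add (ih hf.of_succ hg.2.1)
      rw [zero_mul, mul_zero, add_zero] at h
      refine h.congr ?_
      filter_upwards [hf.1.1, hg.1.1] with z h1 h2
      simp only [ThreeCone.eulerOp]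
      rw [dz_eq (wirtinger_mul (hasFDerivAt_wirtinger (differentiableAt_of_contDiffAt h1))
        (hasFDerivAt_wirtinger (differentiableAt_of_contDiffAt h2)))]
      ring
    · have h := (ih hf.2.2 hg.of_succ).add (ih hf.of_succ hg.2.2)
      rw [zero_mul, mul_zero, add_zero] at h
      refine h.congr ?_
      filter_upwards [hf.1.1, hg.1.1] with z h1 h2
      simp only [ThreeCone.eulerOpBar]
      rw [dzbar_eq (wirtinger_mul (hasFDerivAt_wirtinger (differentiableAt_of_contDiffAt h1))
        (hasFDerivAt_wirtinger (differentiableAt_of_contDiffAt h2)))]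
      ring

lemma Tame.add {c d : ℂ} (hf : Tame f c) (hg : Tame g d) : Tame (fun z => f z + g z) (c + d) :=
  fun k => (hf k).add (hg k)

lemma Tame.mul {c d : ℂ} (hf : Tame f c) (hg : Tame g d) : Tame (fun z => f z * g z) (c * d) :=
  fun k => (hf k).mul (hg k)

/-- A function that is smooth in a full neighbourhood of `0` is tame. -/
lemma tame_of_contDiffAt (h : ∀ᶠ z in 𝓝 (0 : ℂ), ContDiffAt ℝ ∞ f z) : Tame f (f 0) := by
  intro k
  have h0 : ∀ {f : ℂ → ℂ}, (∀ᶠ z in 𝓝 (0 : ℂ), ContDiffAt ℝ ∞ f z) →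
      (∀ᶠ z in 𝓝[≠] (0 : ℂ), ContDiffAt ℝ ∞ f z) ∧ Tendsto f (𝓝[≠] 0) (𝓝 (f 0)) :=
    fun h => ⟨h.filter_mono nhdsWithin_le_nhds,
      h.self_of_nhds.continuousAt.tendsto.mono_left nhdsWithin_le_nhds⟩
  induction k generalizing f with
  | zero => exact h0 h
  | succ k ih =>
    refine ⟨h0 h, ?_, ?_⟩
    · have := @ih (eulerOp f) (h.mono fun z hz => contDiffAt_id.mul (contDiffAt_dz hz))
      simpa [eulerOp] using this
    · have := @ih (eulerOpBar f) (h.mono fun z hz => (contDiffAt_conj z).mul (contDiffAt_dzbar hz))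
      simpa [eulerOpBar] using this

lemma tame_const (c : ℂ) : Tame (fun _ => c) c :=
  tame_of_contDiffAt (f := fun _ => c) (.of_forall fun _ => contDiffAt_const)

/-- Away from `0`, `|z|^s` is an eigenfunction of both Euler operators with eigenvalue `s/2`, so
every Euler word yields a multiple of a function tending to `0`. -/
lemma tame_absPow {s : ℝ} (hs : 0 < s) : Tame (absPow s) 0 := by
  intro k
  have h0 : (∀ᶠ z in 𝓝[≠] (0 : ℂ), ContDiffAt ℝ ∞ (absPow s) z) ∧
      Tendsto (absPow s) (𝓝[≠] 0) (𝓝 0) := by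
    refine ⟨?_, ?_⟩
    · filter_upwards [self_mem_nhdsWithin] with z hz using contDiffAt_absPow s hz
    · have : Continuous (absPow s) :=
        Complex.continuous_ofReal.comp (continuous_norm.rpow_const fun _ => .inr hs.le)
      have h := this.tendsto 0
      simp only [absPow, norm_zero, Real.zero_rpow hs.ne', Complex.ofReal_zero] at h
      exact h.mono_left nhdsWithin_le_nhds
  induction k with
  | zero => exact h0
  | succ k ih =>
    have h := (tame_const ((s / 2 : ℝ) : ℂ) k).mul ih
    rw [mul_zero] at h
    refine ⟨h0, h.congr ?_, h.congr ?_⟩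
    · filter_upwards [self_mem_nhdsWithin] with z (hz : z ≠ 0)
      rw [eulerOp, dz_eq (wirtinger_absPow s hz)]
      field_simp
    · filter_upwards [self_mem_nhdsWithin] with z (hz : z ≠ 0)
      have hcz : conj z ≠ 0 := (map_ne_zero _).2 hz
      rw [eulerOpBar, dzbar_eq (wirtinger_absPow s hz)]
      field_simp

/-- An Euler operator sends `1/f` to `-(Euler derivative of f) · (1/f)²`, so order `k + 1` follows
from order `k` for `1/f` and the product rule. -/
lemma Tame.inv {c : ℂ} (hf : Tame f c) (hc : c ≠ 0) : Tame (fun z => (f z)⁻¹) c⁻¹ := by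
  have hne : ∀ᶠ z in 𝓝[≠] (0 : ℂ), f z ≠ 0 := hf.tendsto.eventually_ne hc
  have hd : ∀ᶠ z in 𝓝[≠] (0 : ℂ), HasFDerivAt (fun w => (f w)⁻¹)
      (wirtinger (-(f z ^ 2)⁻¹ * dz f z) (-(f z ^ 2)⁻¹ * dzbar f z)) z := by
    filter_upwards [hf.contDiffAt, hne] with z h1 h2
    exact wirtinger_comp (hasDerivAt_inv h2)
      (hasFDerivAt_wirtinger (differentiableAt_of_contDiffAt h1))
  have h0 : (∀ᶠ z in 𝓝[≠] (0 : ℂ), ContDiffAt ℝ ∞ (fun z => (f z)⁻¹) z) ∧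
      Tendsto (fun z => (f z)⁻¹) (𝓝[≠] 0) (𝓝 c⁻¹) := by
    refine ⟨?_, hf.tendsto.inv₀ hc⟩
    filter_upwards [hf.contDiffAt, hne] with z h1 h2 using h1.inv h2
  intro k
  induction k with
  | zero => exact h0
  | succ k ih =>
    refine ⟨h0, ?_, ?_⟩
    · have h := ((tame_const (-1) k).mul (hf.eulerOp k)).mul (ih.mul ih)
      simp only [mul_zero, zero_mul] at h
      refine h.congr ?_
      filter_upwards [hd, hne] with z h1 h2
      simp only [ThreeCone.eulerOp]
      rw [dz_eq h1]
      field_simp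
    · have h := ((tame_const (-1) k).mul (hf.eulerOpBar k)).mul (ih.mul ih)
      simp only [mul_zero, zero_mul] at h
      refine h.congr ?_
      filter_upwards [hd, hne] with z h1 h2
      simp only [ThreeCone.eulerOpBar]
      rw [dzbar_eq h1]
      field_simp

/-! ### Iterated Wirtinger derivatives of `|z|^s` times a tame function. -/

lemma hasDerivAt_inv_pow (n : ℕ) (hz : z ≠ 0) :
    HasDerivAt (fun w : ℂ => w⁻¹ ^ n) (-n * (z⁻¹) ^ (n + 1)) z := by
  refine ((hasDerivAt_inv hz).fun_pow n).congr_deriv ?_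
  rcases n with _ | n
  · simp
  · simp only [Nat.add_sub_cancel, ← inv_pow]
    push_cast
    ring

/-- One more `∂` turns `|z|^s z^(-n) G` into `|z|^s z^(-n-1) (z∂G + (s/2 - n) G)`. As `z∂G` tends to
`0`, the limit only picks up the factor `s/2 - n`. -/
lemma iterate_dz_absPow_mul (s : ℝ) (n : ℕ) {c : ℂ} (hg : Tame g c) :
    ∃ G : ℂ → ℂ, Tame G ((∏ i ∈ Finset.range n, ((s / 2 - i : ℝ) : ℂ)) * c) ∧
      dz^[n] (fun z => absPow s z * g z) =ᶠ[𝓝[≠] 0]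
        fun z => absPow s z * ((z⁻¹) ^ n * G z) := by
  induction n with
  | zero => exact ⟨g, by simpa using hg, by simp⟩
  | succ n ih =>
    obtain ⟨G, hG, h⟩ := ih
    refine ⟨fun z => eulerOp G z + ((s / 2 - n : ℝ) : ℂ) * G z, ?_, ?_⟩
    · have := hG.eulerOp.add ((tame_const ((s / 2 - n : ℝ) : ℂ)).mul hG)
      rw [Finset.prod_range_succ]
      convert this using 1
      ring
    · rw [Function.iterate_succ_apply']
      filter_upwards [dz_congr_punctured h, hG.contDiffAt, self_mem_nhdsWithin] with z h1 h2 hz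
      have hz : z ≠ 0 := hz
      rw [h1]
      rw [dz_eq (wirtinger_mul (wirtinger_absPow s hz) (wirtinger_mul (wirtinger_of_hasDerivAt
        (hasDerivAt_inv_pow n hz))
        (hasFDerivAt_wirtinger (differentiableAt_of_contDiffAt h2))))]
      simp only [eulerOp]
      push_cast
      linear_combination (-(absPow s z * z⁻¹ ^ n * dz G z)) * mul_inv_cancel₀ hz

/-- The conjugate computation; the factor `z^(-n)` is holomorphic off `0` and passes through `∂̄`
untouched. -/
lemma iterate_dzbar_absPow_mul (s : ℝ) (n m : ℕ) {c : ℂ} (hg : Tame g c) :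
    ∃ G : ℂ → ℂ, Tame G ((∏ i ∈ Finset.range m, ((s / 2 - i : ℝ) : ℂ)) * c) ∧
      dzbar^[m] (fun z => absPow s z * ((z⁻¹) ^ n * g z)) =ᶠ[𝓝[≠] 0]
        fun z => absPow s z * ((z⁻¹) ^ n * (((conj z)⁻¹) ^ m * G z)) := by
  induction m with
  | zero => exact ⟨g, by simpa using hg, by simp⟩
  | succ m ih =>
    obtain ⟨G, hG, h⟩ := ih
    refine ⟨fun z => eulerOpBar G z + ((s / 2 - m : ℝ) : ℂ) * G z, ?_, ?_⟩
    · have := hG.eulerOpBar.add ((tame_const ((s / 2 - m : ℝ) : ℂ)).mul hG)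
      rw [Finset.prod_range_succ]
      convert this using 1
      ring
    · rw [Function.iterate_succ_apply']
      filter_upwards [dzbar_congr_punctured h, hG.contDiffAt, self_mem_nhdsWithin] with z h1 h2 hz
      have hz : z ≠ 0 := hz
      have hcz : conj z ≠ 0 := (map_ne_zero _).2 hz
      rw [h1]
      rw [dzbar_eq (wirtinger_mul (wirtinger_absPow s hz)
        (wirtinger_mul (wirtinger_of_hasDerivAt (hasDerivAt_inv_pow n hz))
        (wirtinger_mul (wirtinger_comp (hasDerivAt_inv_pow m hcz) (wirtinger_conj z))
        (hasFDerivAt_wirtinger (differentiableAt_of_contDiffAt h2)))))]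
      simp only [eulerOpBar]
      push_cast
      linear_combination (-(absPow s z * z⁻¹ ^ n * (conj z)⁻¹ ^ m * dzbar G z)) *
        mul_inv_cancel₀ hcz

/-- The limits of the weighted Wirtinger derivatives of `|z|ˢ g` for tame `g`. -/
lemma tendsto_iterate_absPow_mul (s : ℝ) (m n : ℕ) {c : ℂ} (hg : Tame g c)
    (hf : f =ᶠ[𝓝[≠] 0] fun z => absPow s z * g z) :
    Tendsto (fun z : ℂ => absPow (-s) z * (conj z) ^ m * z ^ n * (dzbar^[m] (dz^[n] f)) z)
      (𝓝[≠] 0)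
      (𝓝 ((∏ i ∈ Finset.range m, ((s / 2 - i : ℝ) : ℂ)) *
        ((∏ i ∈ Finset.range n, ((s / 2 - i : ℝ) : ℂ)) * c))) := by
  have hdz : ∀ (n : ℕ) {f g : ℂ → ℂ}, f =ᶠ[𝓝[≠] 0] g → dz^[n] f =ᶠ[𝓝[≠] 0] dz^[n] g := by
    intro n
    induction n with
    | zero => exact fun h => h
    | succ n ih => exact fun h => ih (dz_congr_punctured h)
  have hdzbar : ∀ (n : ℕ) {f g : ℂ → ℂ}, f =ᶠ[𝓝[≠] 0] g → dzbar^[n] f =ᶠ[𝓝[≠] 0] dzbar^[n] g := by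
    intro n
    induction n with
    | zero => exact fun h => h
    | succ n ih => exact fun h => ih (dzbar_congr_punctured h)
  obtain ⟨G, hG, h1⟩ := iterate_dz_absPow_mul s n hg
  obtain ⟨G', hG', h2⟩ := iterate_dzbar_absPow_mul s n m hG
  refine hG'.tendsto.congr' ?_
  filter_upwards [(hdzbar m ((hdz n hf).trans h1)).trans h2, self_mem_nhdsWithin] with z hz hz0
  have hz0 : z ≠ 0 := hz0
  have hcz : conj z ≠ 0 := (map_ne_zero _).2 hz0
  rw [hz]
  have : absPow (-s) z * absPow s z = 1 := by
    simp only [absPow]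
    rw [← Complex.ofReal_mul, ← Real.rpow_add (norm_pos_iff.2 hz0)]
    simp
  have e1 : z ^ n * z⁻¹ ^ n = 1 := by rw [← mul_pow, mul_inv_cancel₀ hz0, one_pow]
  have e2 : conj z ^ m * (conj z)⁻¹ ^ m = 1 := by rw [← mul_pow, mul_inv_cancel₀ hcz, one_pow]
  calc G' z = (absPow (-s) z * absPow s z) * (z ^ n * z⁻¹ ^ n) *
        (conj z ^ m * (conj z)⁻¹ ^ m) * G' z := by rw [this, e1, e2]; ring
    _ = _ := by ring

end ThreeCone

end

noncomputable section

namespace ThreeCone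

open MeasureTheory Set ProbabilityTheory

/-! ### Euler's integral -/

/-- The integrand `t^(u-1) (1-t)^(v-1)` of the beta integral. -/
def betaWeight (u v t : ℝ) : ℝ := t ^ (u - 1) * (1 - t) ^ (v - 1)

lemma betaWeight_nonneg {u v t : ℝ} (ht : t ∈ Ioo (0 : ℝ) 1) : 0 ≤ betaWeight u v t :=
  mul_nonneg (Real.rpow_nonneg ht.1.le _) (Real.rpow_nonneg (sub_nonneg.2 ht.2.le) _)

lemma ofReal_betaWeight {u v t : ℝ} (ht : t ∈ Ioo (0 : ℝ) 1) :
    ((betaWeight u v t : ℝ) : ℂ) = (t : ℂ) ^ ((u : ℂ) - 1) * (1 - (t : ℂ)) ^ ((v : ℂ) - 1) := by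
  rw [betaWeight, Complex.ofReal_mul, Complex.ofReal_cpow ht.1.le,
    Complex.ofReal_cpow (sub_nonneg.2 ht.2.le)]
  push_cast
  rfl

variable {a b c u v : ℝ}

lemma integrableOn_betaWeight (hu : 0 < u) (hv : 0 < v) :
    IntegrableOn (betaWeight u v) (Ioo 0 1) := by
  have h := Complex.betaIntegral_convergent (u := u) (v := v) (by simpa) (by simpa)
  rw [intervalIntegrable_iff_integrableOn_Ioo_of_le zero_le_one] at h
  have h2 : IntegrableOn (fun t => ((betaWeight u v t : ℝ) : ℂ)) (Ioo 0 1) :=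
    h.congr_fun (fun t ht => (ofReal_betaWeight ht).symm) measurableSet_Ioo
  exact h2.re

lemma integral_betaWeight (hu : 0 < u) (hv : 0 < v) :
    ∫ t in Ioo 0 1, betaWeight u v t = beta u v := by
  have h : ((∫ t in Ioo 0 1, betaWeight u v t : ℝ) : ℂ) = Complex.betaIntegral u v := by
    rw [← integral_complex_ofReal, Complex.betaIntegral,
      intervalIntegral.integral_of_le zero_le_one, integral_Ioc_eq_integral_Ioo]
    exact setIntegral_congr_fun measurableSet_Ioo fun t ht => ofReal_betaWeight ht
  rw [beta_eq_betaIntegralReal u v hu hv, ← h, Complex.ofReal_re]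

lemma Gamma_add_natCast (hu : 0 < u) (n : ℕ) :
    Real.Gamma (u + n) = (ascPochhammer ℝ n).eval u * Real.Gamma u := by
  induction n with
  | zero => simp
  | succ n ih =>
    rw [Nat.cast_succ, ← add_assoc, Real.Gamma_add_one (by positivity), ih, ascPochhammer_succ_eval]
    ring

lemma beta_add_natCast (hu : 0 < u) (hv : 0 < v) (n : ℕ) :
    beta (u + n) v =
      beta u v * ((ascPochhammer ℝ n).eval u * ((ascPochhammer ℝ n).eval (u + v))⁻¹) := by
  have h : u + n + v = u + v + n := by ring
  have h1 := ascPochhammer_pos n (u + v) (by positivity)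
  have h2 := Real.Gamma_pos_of_pos (add_pos hu hv)
  rw [beta, beta, h, Gamma_add_natCast hu, Gamma_add_natCast (add_pos hu hv)]
  field_simp

lemma ascPochhammer_eval_ofReal (x : ℝ) (n : ℕ) :
    (ascPochhammer ℂ n).eval (x : ℂ) = (((ascPochhammer ℝ n).eval x : ℝ) : ℂ) := by
  induction n with
  | zero => simp
  | succ n ih =>
    rw [ascPochhammer_succ_eval, ascPochhammer_succ_eval, ih]
    push_cast
    rfl

/-- The coefficients of the Gauss series. -/
def gaussCoeff (a b c : ℝ) (n : ℕ) : ℝ :=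
  (n ! : ℝ)⁻¹ * (ascPochhammer ℝ n).eval a * (ascPochhammer ℝ n).eval b *
    ((ascPochhammer ℝ n).eval c)⁻¹

lemma gaussCoeff_succ (hc : 0 < c) (n : ℕ) :
    gaussCoeff a b c (n + 1) * ((n + 1) * (c + n)) = gaussCoeff a b c n * ((a + n) * (b + n)) := by
  have h1 := ascPochhammer_pos n c hc
  have h2 : (0 : ℝ) < n ! := by positivity
  have h3 : (0 : ℝ) < c + n := by positivity
  simp only [gaussCoeff, ascPochhammer_succ_eval, Nat.factorial_succ]
  push_cast
  field_simp

/-- Positive parameters are never nonpositive integers, so the series neither terminates nor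
degenerates and its radius is exactly `1`. -/
lemma summable_gauss (ha : 0 < a) (hb : 0 < b) (hc : 0 < c) {z : ℂ} (hz : ‖z‖ < 1) :
    Summable fun n => ‖(gaussCoeff a b c n : ℂ) * z ^ n‖ := by
  have hr : (ordinaryHypergeometricSeries ℂ (a : ℂ) b c).radius = 1 := by
    refine ordinaryHypergeometricSeries_radius_eq_one ℂ _ _ _ fun k => ⟨?_, ?_, ?_⟩
    all_goals
      intro h
      have := congrArg Complex.re h
      simp only [Complex.natCast_re, Complex.neg_re, Complex.ofReal_re] at this
      have hk : (0 : ℝ) ≤ k := k.cast_nonneg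
      linarith
  have h := (ordinaryHypergeometricSeries ℂ (a : ℂ) b c).summable_norm_apply (x := z)
    (by rw [hr]; simpa [← ofReal_norm] using hz)
  refine h.congr fun n => ?_
  rw [ordinaryHypergeometricSeries_apply_eq]
  simp only [ascPochhammer_eval_ofReal, gaussCoeff, smul_eq_mul]
  push_cast
  rfl

lemma hasSum_gauss (ha : 0 < a) (hb : 0 < b) (hc : 0 < c) {z : ℂ} (hz : ‖z‖ < 1) :
    HasSum (fun n => (gaussCoeff a b c n : ℂ) * z ^ n)
      (ordinaryHypergeometric (a : ℂ) b c z) := by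
  have h : ordinaryHypergeometric (a : ℂ) b c z = ∑' n, (gaussCoeff a b c n : ℂ) * z ^ n := by
    rw [ordinaryHypergeometric_eq_tsum]
    refine tsum_congr fun n => ?_
    simp only [ascPochhammer_eval_ofReal, gaussCoeff, smul_eq_mul]
    push_cast
    rfl
  rw [h]
  exact (summable_gauss ha hb hc hz).of_norm.hasSum

/-- The binomial series, seen as the Gauss series with `b = c = 1`, where `(1)ₙ` cancels and leaves
`(a)ₙ/n!`. -/
lemma hasSum_one_sub_cpow {z : ℂ} (hz : ‖z‖ < 1) (a : ℝ) :
    HasSum (fun n => (gaussCoeff a 1 1 n : ℂ) * z ^ n) ((1 - z) ^ (-(a : ℂ))) := by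
  have h := (Complex.one_add_cpow_hasFPowerSeriesOnBall_zero (a := -(a : ℂ))).hasSum (y := -z)
    (by simpa [← ofReal_norm] using hz)
  rw [binomialSeries_eq_ordinaryHypergeometricSeries (b := (1 : ℂ))
    (fun k hk => by
      have := congrArg Complex.re hk
      simp only [Complex.natCast_re, Complex.neg_re, Complex.one_re] at this
      have hk : (0 : ℝ) ≤ k := k.cast_nonneg
      linarith)] at h
  rw [zero_add, ← sub_eq_add_neg] at h
  have e1 : (1 : ℂ) = ((1 : ℝ) : ℂ) := by simp
  refine (funext fun n => ?_ : (fun n => (gaussCoeff a 1 1 n : ℂ) * z ^ n) = _) ▸ h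
  rw [FormalMultilinearSeries.compContinuousLinearMap_apply]
  have : (⇑(-ContinuousLinearMap.id ℂ ℂ) ∘ fun _ : Fin n => -z) = fun _ => z := by
    ext; simp
  rw [this, neg_neg, ordinaryHypergeometricSeries_apply_eq, e1]
  simp only [ascPochhammer_eval_ofReal, gaussCoeff, smul_eq_mul]
  push_cast
  rfl

/-- Euler's integral `∫₀¹ t^(b-1) (1-t)^(c-b-1) (1-tz)^(-a) dt`. -/
def eulerIntegral (a b c : ℝ) (z : ℂ) : ℂ :=
  ∫ t in Ioo (0 : ℝ) 1, (betaWeight b (c - b) t : ℂ) * (1 - t * z) ^ (-(a : ℂ))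

/-- Expand `(1 - tz)^(-a)` binomially and integrate term by term: `B(b+n, c-b) = B(b, c-b)
(b)ₙ/(c)ₙ` supplies the missing Pochhammer symbols. Summability of the norms justifies the
interchange. -/
lemma eulerIntegral_eq_series (ha : 0 < a) (hb : 0 < b) (hbc : b < c) {z : ℂ} (hz : ‖z‖ < 1) :
    eulerIntegral a b c z = beta b (c - b) * ordinaryHypergeometric (a : ℂ) b c z := by
  have hcb : 0 < c - b := sub_pos.2 hbc
  set F : ℕ → ℝ → ℂ := fun n t =>
    ((gaussCoeff a 1 1 n : ℂ) * z ^ n) * (betaWeight (b + n) (c - b) t : ℂ) with hF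
  have hint : ∀ n : ℕ, IntegrableOn (betaWeight (b + n) (c - b)) (Ioo 0 1) := fun n =>
    integrableOn_betaWeight (by positivity) hcb
  have hcoef : ∀ n : ℕ, gaussCoeff a 1 1 n * beta (b + n) (c - b) =
      beta b (c - b) * gaussCoeff a b c n := by
    intro n
    rw [beta_add_natCast hb hcb, gaussCoeff, gaussCoeff, add_sub_cancel]
    have := ascPochhammer_pos n (1 : ℝ) one_pos
    field_simp
  have hI : ∀ n, ∫ t in Ioo (0 : ℝ) 1, F n t =
      beta b (c - b) * ((gaussCoeff a b c n : ℂ) * z ^ n) := by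
    intro n
    simp only [hF]
    rw [integral_const_mul, integral_complex_ofReal, integral_betaWeight (by positivity) hcb]
    have := congrArg (fun x : ℝ => (x : ℂ)) (hcoef n)
    push_cast at this
    linear_combination z ^ n * this
  have hN : ∀ n, ∫ t in Ioo (0 : ℝ) 1, ‖F n t‖ =
      |beta b (c - b)| * ‖(gaussCoeff a b c n : ℂ) * z ^ n‖ := by
    intro n
    have : ∫ t in Ioo (0 : ℝ) 1, ‖F n t‖ = ∫ t in Ioo (0 : ℝ) 1,
        ‖(gaussCoeff a 1 1 n : ℂ) * z ^ n‖ * betaWeight (b + n) (c - b) t := by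
      refine setIntegral_congr_fun measurableSet_Ioo fun t ht => ?_
      simp only [hF]
      rw [norm_mul, Complex.norm_real, Real.norm_of_nonneg (betaWeight_nonneg ht)]
    rw [this, integral_const_mul, integral_betaWeight (by positivity) hcb]
    have h1 := congrArg abs (hcoef n)
    rw [abs_mul, abs_mul, abs_of_pos (beta_pos (by positivity : 0 < b + n) hcb)] at h1
    rw [norm_mul, norm_mul, Complex.norm_real, Complex.norm_real, Real.norm_eq_abs,
      Real.norm_eq_abs]
    linear_combination ‖z ^ n‖ * h1
  have h := hasSum_integral_of_summable_integral_norm (μ := volume.restrict (Ioo (0 : ℝ) 1))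
    (F := F) (fun n => (hint n).ofReal.const_mul _)
    (by
      simp only [hN]
      exact (summable_gauss ha hb (hb.trans hbc) hz).mul_left _)
  simp only [hI] at h
  rw [((hasSum_gauss ha hb (hb.trans hbc) hz).mul_left _).unique h, eulerIntegral]
  refine setIntegral_congr_fun measurableSet_Ioo fun t ht => ?_
  have htz : ‖(t : ℂ) * z‖ < 1 := by
    rw [norm_mul, Complex.norm_real, Real.norm_of_nonneg ht.1.le]
    nlinarith [ht.1, ht.2, norm_nonneg z]
  have h2 := (hasSum_one_sub_cpow htz a).mul_left (betaWeight b (c - b) t : ℂ)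
  rw [← h2.tsum_eq]
  refine tsum_congr fun n => ?_
  have h3 : betaWeight (b + n) (c - b) t = t ^ n * betaWeight b (c - b) t := by
    rw [betaWeight, betaWeight, show b + n - 1 = (b - 1) + n by ring, Real.rpow_add_natCast ht.1.ne']
    ring
  simp only [hF]
  rw [h3]
  push_cast
  ring

/-! ### Continuation of the Gauss series to the slit plane. -/

lemma isOpen_slitAtOne : IsOpen slitAtOne :=
  Complex.isOpen_slitPlane.preimage (continuous_const.sub continuous_id)

/-- `1 - tz` lies on the segment from `1` to `1 - z`, and the slit plane is star-shaped about `1`.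
-/
lemma one_sub_mul_mem_slitPlane {z : ℂ} (hz : z ∈ slitAtOne) {t : ℝ} (ht : t ∈ Icc (0 : ℝ) 1) :
    1 - t * z ∈ Complex.slitPlane := by
  have h := Complex.starConvex_one_slitPlane hz (sub_nonneg.2 ht.2) ht.1 (by ring)
  convert h using 1
  simp only [Complex.real_smul]
  push_cast
  ring

lemma mul_mem_slitAtOne {z : ℂ} (hz : z ∈ slitAtOne) {t : ℝ} (ht : t ∈ Icc (0 : ℝ) 1) :
    t * z ∈ slitAtOne := one_sub_mul_mem_slitPlane hz ht

lemma ball_subset_slitAtOne : Metric.ball (0 : ℂ) 1 ⊆ slitAtOne := by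
  intro z hz
  have : ‖-z‖ < 1 := by simpa using hz
  have h := Complex.mem_slitPlane_of_norm_lt_one this
  rwa [← sub_eq_add_neg] at h

lemma isPreconnected_slitAtOne : IsPreconnected slitAtOne := by
  refine (StarConvex.isPathConnected (a := (0 : ℂ)) ?_
    (ball_subset_slitAtOne (Metric.mem_ball_self one_pos))).isConnected.isPreconnected
  rw [starConvex_zero_iff]
  intro z hz t ht0 ht1
  rw [Complex.real_smul]
  exact mul_mem_slitAtOne hz ⟨ht0, ht1⟩

lemma conj_mem_slitAtOne {z : ℂ} (hz : z ∈ slitAtOne) : conj z ∈ slitAtOne := by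
  have h : 1 - z ∈ Complex.slitPlane := hz
  have : 1 - conj z ∈ Complex.slitPlane := by
    rw [Complex.mem_slitPlane_iff] at h ⊢
    simpa using h
  exact this

lemma continuousOn_eulerIntegrand (a b c : ℝ) {z : ℂ} (hz : z ∈ slitAtOne) :
    ContinuousOn (fun t : ℝ => (betaWeight b (c - b) t : ℂ) * (1 - t * z) ^ (-(a : ℂ)))
      (Ioo 0 1) := by
  intro t ht
  have h1 : (1 : ℝ) - t ≠ 0 := sub_ne_zero.2 ht.2.ne'
  have h2 : ContinuousAt (betaWeight b (c - b)) t :=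
    (Real.continuousAt_rpow_const _ _ (.inl ht.1.ne')).mul
      ((continuousAt_const.sub continuousAt_id).rpow_const (.inl h1))
  have h3 : ContinuousAt (fun t : ℝ => (1 - (t : ℂ) * z) ^ (-(a : ℂ))) t :=
    ContinuousAt.cpow (by fun_prop) continuousAt_const
      (one_sub_mul_mem_slitPlane hz ⟨ht.1.le, ht.2.le⟩)
  exact ((Complex.continuous_ofReal.continuousAt.comp h2).mul h3).continuousWithinAt

lemma differentiableOn_eulerIntegral (a : ℝ) (hb : 0 < b) (hbc : b < c) :
    DifferentiableOn ℂ (eulerIntegral a b c) slitAtOne := by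
  intro z₀ hz₀
  have hcb : 0 < c - b := sub_pos.2 hbc
  obtain ⟨ε, hε, hsub⟩ := Metric.nhds_basis_closedBall.mem_iff.1 (isOpen_slitAtOne.mem_nhds hz₀)
  have hcont : ∀ s : ℂ, ContinuousOn (fun p : ℝ × ℂ => (1 - (p.1 : ℂ) * p.2) ^ s)
      (Icc (0 : ℝ) 1 ×ˢ Metric.closedBall z₀ ε) := fun s p hp =>
    (ContinuousAt.cpow (f := fun p : ℝ × ℂ => 1 - (p.1 : ℂ) * p.2) (by fun_prop) continuousAt_const
      (one_sub_mul_mem_slitPlane (hsub hp.2) hp.1)).continuousWithinAt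
  have hK : IsCompact (Icc (0 : ℝ) 1 ×ˢ Metric.closedBall z₀ ε) :=
    isCompact_Icc.prod (isCompact_closedBall z₀ ε)
  -- `1 - tz` stays in the slit plane on a compact set, endpoints included, so its powers are
  -- bounded and the beta weight alone dominates.
  obtain ⟨M, hM⟩ := hK.exists_bound_of_continuousOn (hcont (-(a : ℂ)))
  obtain ⟨M', hM'⟩ := hK.exists_bound_of_continuousOn (hcont (-(a : ℂ) - 1))
  have hmeas : ∀ z ∈ slitAtOne, AEStronglyMeasurable
      (fun t : ℝ => (betaWeight b (c - b) t : ℂ) * (1 - t * z) ^ (-(a : ℂ)))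
      (volume.restrict (Ioo 0 1)) := fun z hz =>
    (continuousOn_eulerIntegrand a b c hz).aestronglyMeasurable measurableSet_Ioo
  have hw : IntegrableOn (fun t : ℝ => ((betaWeight b (c - b) t : ℝ) : ℂ)) (Ioo 0 1) :=
    (integrableOn_betaWeight hb hcb).ofReal
  have hz₀' : z₀ ∈ Metric.closedBall z₀ ε := Metric.mem_closedBall_self hε.le
  have hmem : ∀ᵐ t ∂(volume.restrict (Ioo (0 : ℝ) 1)), t ∈ Ioo (0 : ℝ) 1 :=
    ae_restrict_mem measurableSet_Ioo
  have h := hasDerivAt_integral_of_dominated_loc_of_deriv_le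
    (μ := volume.restrict (Ioo (0 : ℝ) 1)) (𝕜 := ℂ)
    (F := fun z t => (betaWeight b (c - b) t : ℂ) * (1 - t * z) ^ (-(a : ℂ)))
    (F' := fun z t => (betaWeight b (c - b) t : ℂ) *
      ((a : ℂ) * t * (1 - t * z) ^ (-(a : ℂ) - 1)))
    (x₀ := z₀) (s := Metric.closedBall z₀ ε)
    (bound := fun t => |a| * M' * betaWeight b (c - b) t)
    (Metric.closedBall_mem_nhds z₀ hε)
    (by
      filter_upwards [isOpen_slitAtOne.mem_nhds hz₀] with z hz using hmeas z hz)
    (by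
      refine hw.mul_bdd (c := M) ?_ ?_
      · refine ContinuousOn.aestronglyMeasurable ?_ measurableSet_Ioo
        exact (hcont _).comp (f := fun t : ℝ => (t, z₀)) (by fun_prop)
          fun t ht => ⟨⟨ht.1.le, ht.2.le⟩, hz₀'⟩
      · filter_upwards [hmem] with t ht using hM (t, z₀) ⟨⟨ht.1.le, ht.2.le⟩, hz₀'⟩)
    (by
      refine hw.aestronglyMeasurable.mul
        (ContinuousOn.aestronglyMeasurable ?_ measurableSet_Ioo)
      refine ContinuousOn.mul (by fun_prop) ?_
      exact (hcont _).comp (f := fun t : ℝ => (t, z₀)) (by fun_prop)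
          fun t ht => ⟨⟨ht.1.le, ht.2.le⟩, hz₀'⟩)
    (by
      filter_upwards [hmem] with t ht z hz
      have h1 := hM' (t, z) ⟨⟨ht.1.le, ht.2.le⟩, hz⟩
      have h2 := betaWeight_nonneg (u := b) (v := c - b) ht
      rw [norm_mul, norm_mul, norm_mul, Complex.norm_real, Complex.norm_real, Complex.norm_real,
        Real.norm_of_nonneg h2, Real.norm_of_nonneg ht.1.le, Real.norm_eq_abs]
      have h3 : |a| * t * ‖(1 - (t : ℂ) * z) ^ (-(a : ℂ) - 1)‖ ≤ |a| * M' := by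
        have : t * ‖(1 - (t : ℂ) * z) ^ (-(a : ℂ) - 1)‖ ≤ 1 * M' :=
          mul_le_mul ht.2.le h1 (norm_nonneg _) zero_le_one
        rw [mul_assoc]
        exact mul_le_mul_of_nonneg_left (by linarith) (abs_nonneg a)
      nlinarith)
    ((integrableOn_betaWeight hb hcb).const_mul _)
    (by
      filter_upwards [hmem] with t ht z hz
      have h1 : HasDerivAt (fun z : ℂ => 1 - (t : ℂ) * z) (-(t : ℂ)) z := by
        simpa using ((hasDerivAt_id z).const_mul (t : ℂ)).const_sub 1
      have h2 := (h1.cpow_const (c := -(a : ℂ))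
        (one_sub_mul_mem_slitPlane (hsub hz) ⟨ht.1.le, ht.2.le⟩)).const_mul
        (betaWeight b (c - b) t : ℂ)
      refine h2.congr_deriv ?_
      ring)
  exact h.2.differentiableAt.differentiableWithinAt

lemma beta_ofReal_ne_zero (hu : 0 < u) (hv : 0 < v) : ((beta u v : ℝ) : ℂ) ≠ 0 :=
  Complex.ofReal_ne_zero.2 (beta_pos hu hv).ne'

lemma isGaussContinuation_eulerIntegral (ha : 0 < a) (hb : 0 < b) (hbc : b < c) :
    IsGaussContinuation a b c (fun z => (beta b (c - b) : ℂ)⁻¹ * eulerIntegral a b c z) := by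
  refine ⟨(differentiableOn_eulerIntegral a hb hbc).const_mul _, fun z hz => ?_⟩
  have := beta_ofReal_ne_zero hb (sub_pos.2 hbc)
  simp only [eulerIntegral_eq_series ha hb hbc hz]
  field_simp

lemma isGaussContinuation_gaussContinuation (ha : 0 < a) (hb : 0 < b) (hbc : b < c) :
    IsGaussContinuation a b c (gaussContinuation a b c) := by
  have h : ∃ f, IsGaussContinuation a b c f := ⟨_, isGaussContinuation_eulerIntegral ha hb hbc⟩
  rw [gaussContinuation, dif_pos h]
  exact h.choose_spec

/-- The continuation is an arbitrary choice; the identity theorem on the connected slit domain pins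
it down there. -/
lemma gaussContinuation_eq_eulerIntegral (ha : 0 < a) (hb : 0 < b) (hbc : b < c) {z : ℂ}
    (hz : z ∈ slitAtOne) :
    gaussContinuation a b c z = (beta b (c - b) : ℂ)⁻¹ * eulerIntegral a b c z := by
  have h1 := isGaussContinuation_gaussContinuation ha hb hbc
  have h2 := isGaussContinuation_eulerIntegral ha hb hbc
  refine (h1.1.analyticOnNhd isOpen_slitAtOne).eqOn_of_preconnected_of_eventuallyEq
    (h2.1.analyticOnNhd isOpen_slitAtOne) isPreconnected_slitAtOne (z₀ := 0)
    (ball_subset_slitAtOne (Metric.mem_ball_self one_pos)) ?_ hz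
  filter_upwards [Metric.ball_mem_nhds (0 : ℂ) one_pos] with w hw
  have hw : ‖w‖ < 1 := by simpa using hw
  exact (h1.2 w hw).trans (h2.2 w hw).symm

/-- The parameters and the beta weight are real, and principal powers commute with conjugation off
the negative axis. -/
lemma gaussContinuation_conj (ha : 0 < a) (hb : 0 < b) (hbc : b < c) {z : ℂ}
    (hz : z ∈ slitAtOne) :
    gaussContinuation a b c (conj z) = conj (gaussContinuation a b c z) := by
  rw [gaussContinuation_eq_eulerIntegral ha hb hbc hz,
    gaussContinuation_eq_eulerIntegral ha hb hbc (conj_mem_slitAtOne hz), map_mul, map_inv₀,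
    Complex.conj_ofReal, eulerIntegral, eulerIntegral, ← integral_conj]
  congr 1
  refine setIntegral_congr_fun measurableSet_Ioo fun t ht => ?_
  have h := Complex.slitPlane_arg_ne_pi (one_sub_mul_mem_slitPlane hz ⟨ht.1.le, ht.2.le⟩)
  have h2 := Complex.conj_cpow (1 - t * z) (-(a : ℂ)) h
  simp only [map_sub, map_mul, map_one, Complex.conj_ofReal, map_neg] at h2 ⊢
  rw [h2]

/-- Gauss's summation theorem, as a radial limit. -/
lemma tendsto_gaussContinuation_one (ha : 0 < a) (hb : 0 < b) (hbc : b < c) (habc : a + b < c) :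
    Tendsto (fun x : ℝ => gaussContinuation a b c (1 - x)) (𝓝[>] 0)
      (𝓝 ((beta b (c - a - b) / beta b (c - b) : ℝ) : ℂ)) := by
  have hcab : 0 < c - a - b := by linarith
  have hmem : ∀ᵐ t ∂(volume.restrict (Ioo (0 : ℝ) 1)), t ∈ Ioo (0 : ℝ) 1 :=
    ae_restrict_mem measurableSet_Ioo
  have hslit : ∀ x : ℝ, 0 < x → (1 - (x : ℂ)) ∈ slitAtOne := by
    intro x hx
    have : 1 - (1 - (x : ℂ)) ∈ Complex.slitPlane := by
      rw [sub_sub_cancel]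
      exact Complex.ofReal_mem_slitPlane.2 hx
    exact this
  have hlim : Tendsto (fun x : ℝ => eulerIntegral a b c (1 - x)) (𝓝[>] 0)
      (𝓝 (∫ t in Ioo (0 : ℝ) 1, ((betaWeight b (c - a - b) t : ℝ) : ℂ))) := by
    refine tendsto_integral_filter_of_dominated_convergence (betaWeight b (c - a - b)) ?_ ?_
      (integrableOn_betaWeight hb hcab) ?_
    · filter_upwards [self_mem_nhdsWithin] with x hx
      exact (continuousOn_eulerIntegrand a b c (hslit x hx)).aestronglyMeasurable measurableSet_Ioo
    · filter_upwards [self_mem_nhdsWithin] with x hx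
      filter_upwards [hmem] with t ht
      have hx : 0 < x := hx
      have h1 : 0 < 1 - t := sub_pos.2 ht.2
      -- As `-a < 0`, this bounds the integrand by its value at `x = 0`, the weight `betaWeight b (c
      -- - a - b)`, integrable because `a + b < c`.
      have h2 : 1 - t ≤ 1 - t * (1 - x) := by nlinarith [ht.1]
      have e : (1 - (t : ℂ) * (1 - x)) = ((1 - t * (1 - x) : ℝ) : ℂ) := by push_cast; rfl
      rw [norm_mul, Complex.norm_real, Real.norm_of_nonneg (betaWeight_nonneg ht), e,
        Complex.norm_cpow_eq_rpow_re_of_pos (by linarith)]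
      simp only [Complex.neg_re, Complex.ofReal_re]
      have h3 : (1 - t * (1 - x)) ^ (-a) ≤ (1 - t) ^ (-a) :=
        Real.rpow_le_rpow_of_nonpos h1 h2 (by linarith)
      calc betaWeight b (c - b) t * (1 - t * (1 - x)) ^ (-a)
          ≤ betaWeight b (c - b) t * (1 - t) ^ (-a) :=
            mul_le_mul_of_nonneg_left h3 (betaWeight_nonneg ht)
        _ = betaWeight b (c - a - b) t := by
            rw [betaWeight, betaWeight, mul_assoc, ← Real.rpow_add h1]
            ring_nf
    · filter_upwards [hmem] with t ht
      have h1 : 0 < 1 - t := sub_pos.2 ht.2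
      have e : ((betaWeight b (c - a - b) t : ℝ) : ℂ) =
          (betaWeight b (c - b) t : ℂ) * (1 - (t : ℂ) * (1 - (0 : ℝ))) ^ (-(a : ℂ)) := by
        have e1 : (1 - (t : ℂ) * (1 - (0 : ℝ))) ^ (-(a : ℂ)) = (((1 - t) ^ (-a) : ℝ) : ℂ) := by
          rw [Complex.ofReal_cpow h1.le]
          push_cast
          ring_nf
        rw [e1, ← Complex.ofReal_mul, betaWeight, betaWeight, mul_assoc, ← Real.rpow_add h1]
        ring_nf
      rw [e]
      refine Tendsto.mono_left ?_ nhdsWithin_le_nhds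
      have : ContinuousAt (fun x : ℝ => (betaWeight b (c - b) t : ℂ) *
          (1 - (t : ℂ) * (1 - (x : ℂ))) ^ (-(a : ℂ))) 0 := by
        refine continuousAt_const.mul (ContinuousAt.cpow (by fun_prop) continuousAt_const ?_)
        have : (1 - (t : ℂ) * (1 - ((0 : ℝ) : ℂ))) = ((1 - t : ℝ) : ℂ) := by push_cast; ring
        rw [this]
        exact Complex.ofReal_mem_slitPlane.2 h1
      exact this.tendsto
  rw [integral_complex_ofReal, integral_betaWeight hb hcab] at hlim
  have h := hlim.const_mul ((beta b (c - b) : ℂ)⁻¹)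
  have e : (((beta b (c - a - b) / beta b (c - b) : ℝ)) : ℂ) =
      (beta b (c - b) : ℂ)⁻¹ * (beta b (c - a - b) : ℂ) := by
    push_cast
    ring
  rw [e]
  refine h.congr' ?_
  filter_upwards [self_mem_nhdsWithin] with x hx
  rw [gaussContinuation_eq_eulerIntegral ha hb hbc (hslit x hx)]

end ThreeCone

end

noncomputable section

namespace ThreeCone

open MeasureTheory Set ProbabilityTheory

/-! ### Power series and the hypergeometric equation -/

lemma hasSum_of_forall_eq {f g : ℕ → ℂ} {s : ℂ} (h : HasSum f s) (e : ∀ n, f n = g n) :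
    HasSum g s := funext e ▸ h

lemma hasSum_shift {v : ℕ → ℂ} {z s : ℂ} (hv : v 0 = 0)
    (h : HasSum (fun n => v (n + 1) * z ^ n) s) : HasSum (fun n => v n * z ^ n) (z * s) := by
  rw [← hasSum_nat_add_iff' 1]
  simp only [Finset.range_one, Finset.sum_singleton, hv, zero_mul, sub_zero]
  refine hasSum_of_forall_eq (h.mul_left z) fun n => ?_
  ring

lemma hasSum_deriv_of_hasSum {v : ℕ → ℂ} {f : ℂ → ℂ} {R : ℝ} (hR : 0 < R)
    (h : ∀ z : ℂ, ‖z‖ < R → HasSum (fun n => v n * z ^ n) (f z)) {z : ℂ} (hz : ‖z‖ < R) :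
    HasDerivAt f (deriv f z) z ∧
      HasSum (fun n : ℕ => ((n + 1 : ℕ) : ℂ) * v (n + 1) * z ^ n) (deriv f z) := by
  set p := FormalMultilinearSeries.ofScalars ℂ v with hp
  have hpa : ∀ (n : ℕ) (y : ℂ), (p n fun _ => y) = v n * y ^ n := by
    intro n y
    rw [hp, FormalMultilinearSeries.ofScalars_apply_eq, smul_eq_mul]
  have hball : HasFPowerSeriesOnBall f p 0 (ENNReal.ofReal R) := by
    refine ⟨?_, ENNReal.ofReal_pos.2 hR, ?_⟩
    · refine ENNReal.le_of_forall_nnreal_lt fun r hr => ?_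
      have hr' : (r : ℝ) < R := by
        rwa [← ENNReal.ofReal_coe_nnreal, ENNReal.ofReal_lt_ofReal_iff hR] at hr
      have h1 := (h (r : ℝ) (by simpa using hr')).summable.tendsto_atTop_zero.norm
      refine p.le_radius_of_tendsto (l := ‖(0 : ℂ)‖) (h1.congr fun n => ?_)
      rw [hp, FormalMultilinearSeries.ofScalars_norm, norm_mul, norm_pow]
      simp
    · intro y hy
      have hy' : ‖y‖ < R := by
        rwa [Metric.mem_eball, edist_zero_right, ← ofReal_norm,
          ENNReal.ofReal_lt_ofReal_iff hR] at hy
      simpa only [hpa, zero_add] using h y hy'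
  have hz' : z ∈ Metric.eball (0 : ℂ) (ENNReal.ofReal R) := by
    rwa [Metric.mem_eball, edist_zero_right, ← ofReal_norm, ENNReal.ofReal_lt_ofReal_iff hR]
  have hd : DifferentiableAt ℂ f z := hball.differentiableOn.differentiableAt
    (Metric.isOpen_eball.mem_nhds hz')
  refine ⟨hd.hasDerivAt, ?_⟩
  have h1 := (hball.fderiv.hasSum hz').mapL (ContinuousLinearMap.apply ℂ ℂ (1 : ℂ))
  simp only [zero_add, ContinuousLinearMap.apply_apply, fderiv_apply_one_eq_deriv] at h1
  refine hasSum_of_forall_eq h1 fun n => ?_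
  rw [FormalMultilinearSeries.apply_eq_pow_smul_coeff, smul_apply,
    FormalMultilinearSeries.derivSeries_coeff_one, hp, FormalMultilinearSeries.coeff_ofScalars]
  simp only [smul_eq_mul, nsmul_eq_mul]
  push_cast
  ring

variable {a b c : ℝ}

/-- The left-hand side of the hypergeometric equation. -/
def gaussOp (a b c : ℝ) (f : ℂ → ℂ) (z : ℂ) : ℂ :=
  z * (1 - z) * deriv (deriv f) z + (c - (a + b + 1) * z) * deriv f z - a * b * f z

/-- Comparing coefficients of `zⁿ`, the differential equation is the two-term recurrence
`gaussCoeff_succ`. -/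
lemma gaussOp_eq_zero_of_hasSum (hc : 0 < c) {f : ℂ → ℂ}
    (h : ∀ z : ℂ, ‖z‖ < 1 → HasSum (fun n => (gaussCoeff a b c n : ℂ) * z ^ n) (f z)) {z : ℂ}
    (hz : ‖z‖ < 1) : gaussOp a b c f z = 0 := by
  set v : ℕ → ℂ := fun n => (gaussCoeff a b c n : ℂ) with hv
  have h1 : ∀ w : ℂ, ‖w‖ < 1 →
      HasSum (fun n : ℕ => ((n + 1 : ℕ) : ℂ) * v (n + 1) * w ^ n) (deriv f w) :=
    fun w hw => (hasSum_deriv_of_hasSum one_pos h hw).2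
  have h2 := (hasSum_deriv_of_hasSum one_pos h1 hz).2
  have h3 := hasSum_shift (v := fun n : ℕ => (n : ℂ) * v n) (by simp) (h1 z hz)
  have h4 := hasSum_shift (v := fun n : ℕ => (n : ℂ) * (((n + 1 : ℕ) : ℂ) * v (n + 1)))
    (by simp) h2
  -- The series of `z² f''`, obtained by shifting that of `z f''` once more.
  have h5 := hasSum_shift (v := fun n : ℕ => ((n : ℂ) - 1) * ((n : ℂ) * v n)) (by simp)
    (z := z) (s := z * deriv (deriv f) z) (by
      refine hasSum_of_forall_eq h4 fun n => ?_
      push_cast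
      ring)
  have h6 := (((h4.sub h5).add ((h1 z hz).mul_left (c : ℂ))).sub
    (h3.mul_left ((a : ℂ) + b + 1))).sub ((h z hz).mul_left ((a : ℂ) * b))
  have h7 : (fun n : ℕ => (n : ℂ) * (((n + 1 : ℕ) : ℂ) * v (n + 1)) * z ^ n -
      ((n : ℂ) - 1) * ((n : ℂ) * v n) * z ^ n + (c : ℂ) * (((n + 1 : ℕ) : ℂ) * v (n + 1) * z ^ n) -
      ((a : ℂ) + b + 1) * ((n : ℂ) * v n * z ^ n) - (a : ℂ) * b * (v n * z ^ n)) = fun _ => 0 := by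
    funext n
    have := congrArg (fun x : ℝ => (x : ℂ)) (gaussCoeff_succ (a := a) (b := b) hc n)
    push_cast at this
    simp only [hv]
    push_cast
    linear_combination z ^ n * this
  have h8 : HasSum (fun _ : ℕ => (0 : ℂ)) _ := h7 ▸ h6
  rw [gaussOp, ← h8.unique hasSum_zero]
  ring

lemma gaussOp_gaussContinuation (ha : 0 < a) (hb : 0 < b) (hbc : b < c) {z : ℂ}
    (hz : z ∈ slitAtOne) : gaussOp a b c (gaussContinuation a b c) z = 0 := by
  have hG := isGaussContinuation_gaussContinuation ha hb hbc
  set G := gaussContinuation (a : ℂ) b c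
  have hA := hG.1.analyticOnNhd isOpen_slitAtOne
  have hE : AnalyticOnNhd ℂ (gaussOp a b c G) slitAtOne := by
    intro w hw
    have h0 := hA w hw
    have h1 := h0.deriv
    have h2 := h1.deriv
    unfold gaussOp
    fun_prop
  refine hE.eqOn_of_preconnected_of_eventuallyEq (g := fun _ => 0) (fun _ _ => analyticAt_const)
    isPreconnected_slitAtOne (z₀ := 0) (ball_subset_slitAtOne (Metric.mem_ball_self one_pos)) ?_ hz
  filter_upwards [Metric.ball_mem_nhds (0 : ℂ) one_pos] with w hw
  have hw : ‖w‖ < 1 := by simpa using hw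
  refine gaussOp_eq_zero_of_hasSum (hb.trans hbc) (fun z hz => ?_) hw
  rw [hG.2 z hz]
  exact hasSum_gauss ha hb (hb.trans hbc) hz

/-- Solving `(1 - c) H + z H' = h` for analytic `H`. -/
lemma exists_analyticAt_euler_eq {h : ℂ → ℂ} (hh : AnalyticAt ℂ h 0) {c : ℝ} (hc : c < 1) :
    ∃ H : ℂ → ℂ, AnalyticAt ℂ H 0 ∧
      ∀ᶠ z in 𝓝 (0 : ℂ), HasDerivAt H (deriv H z) z ∧
        (1 - (c : ℂ)) * H z + z * deriv H z = h z := by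
  obtain ⟨p, hp⟩ := hh
  rw [hasFPowerSeriesAt_iff] at hp
  obtain ⟨R, hR, hp⟩ := Metric.eventually_nhds_iff.1 hp
  have hp : ∀ z : ℂ, ‖z‖ < R → HasSum (fun n => p.coeff n * z ^ n) (h z) := by
    intro z hz
    have := hp (y := z) (by simpa using hz)
    simpa only [zero_add, smul_eq_mul, mul_comm] using this
  have hden : ∀ n : ℕ, (n : ℂ) + (1 - c : ℝ) ≠ 0 := by
    intro n hn
    have := congrArg Complex.re hn
    simp only [Complex.add_re, Complex.natCast_re, Complex.ofReal_re, Complex.zero_re] at this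
    have hn : (0 : ℝ) ≤ n := n.cast_nonneg
    linarith
  -- The operator multiplies the `n`-th coefficient by `n + 1 - c ≥ 1 - c > 0`, so it is inverted
  -- termwise without loss of radius.
  set v : ℕ → ℂ := fun n => p.coeff n / ((n : ℂ) + (1 - c : ℝ)) with hv
  have hs : ∀ z : ℂ, ‖z‖ < R → HasSum (fun n => v n * z ^ n) (∑' n, v n * z ^ n) := by
    intro z hz
    refine Summable.hasSum (.of_norm_bounded ((hp z hz).summable.norm.mul_left (1 - c)⁻¹) ?_)
    intro n
    have h1 : (1 - c) ≤ ‖(n : ℂ) + (1 - c : ℝ)‖ := by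
      have h2 : (n : ℂ) + (1 - c : ℝ) = ((n + (1 - c) : ℝ) : ℂ) := by push_cast; rfl
      have hn : (0 : ℝ) ≤ n := n.cast_nonneg
      rw [h2, Complex.norm_real, Real.norm_of_nonneg (by linarith)]
      linarith
    have h0 : 0 < 1 - c := sub_pos.2 hc
    rw [norm_mul, norm_mul, hv, norm_div, div_mul_eq_mul_div, inv_mul_eq_div]
    exact div_le_div_of_nonneg_left (by positivity) h0 h1
  refine ⟨fun z => ∑' n, v n * z ^ n, ?_, ?_⟩
  · have hd : DifferentiableOn ℂ (fun z => ∑' n, v n * z ^ n) (Metric.ball 0 R) := fun z hz =>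
      (hasSum_deriv_of_hasSum hR hs (by simpa using hz)).1.differentiableAt.differentiableWithinAt
    exact hd.analyticAt (Metric.ball_mem_nhds 0 hR)
  · filter_upwards [Metric.ball_mem_nhds (0 : ℂ) hR] with z hz
    have hz : ‖z‖ < R := by simpa using hz
    obtain ⟨h1, h2⟩ := hasSum_deriv_of_hasSum hR hs hz
    refine ⟨h1, ?_⟩
    have h3 := hasSum_shift (v := fun n : ℕ => (n : ℂ) * v n) (by simp) h2
    have h4 := ((hs z hz).mul_left (1 - (c : ℂ))).add h3
    refine h4.unique (hasSum_of_forall_eq (hp z hz) fun n => ?_)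
    have := hden n
    simp only [hv]
    push_cast at this ⊢
    field_simp
    ring

/-- The difference of the quotient of two solutions of the hypergeometric equation and a constant
is `z^(1-c)` times an analytic function. -/
lemma exists_eq_add_cpow_mul {y₁ y₂ : ℂ → ℂ} {r : ℝ} (hr : 0 < r) (hr1 : r ≤ 1) (hc : c < 1)
    (h₁ : DifferentiableOn ℂ y₁ (Metric.ball 0 r)) (h₁0 : y₁ 0 = 1)
    (h₂ : DifferentiableOn ℂ y₂ Complex.slitPlane)
    (ode₁ : ∀ z ∈ Metric.ball (0 : ℂ) r, gaussOp a b c y₁ z = 0)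
    (ode₂ : ∀ z ∈ Complex.slitPlane, gaussOp a b c y₂ z = 0) :
    ∃ (A : ℂ) (H : ℂ → ℂ), AnalyticAt ℂ H 0 ∧
      ∀ᶠ z in 𝓝 (0 : ℂ), z ∈ Complex.slitPlane →
        y₂ z = A * y₁ z + z ^ (1 - (c : ℂ)) * H z := by
  set d : ℂ := a + b + 1 - c with hd
  have hA₁ := h₁.analyticOnNhd Metric.isOpen_ball
  have hA₂ := h₂.analyticOnNhd Complex.isOpen_slitPlane
  have h0 : AnalyticAt ℂ y₁ 0 := hA₁ 0 (Metric.mem_ball_self hr)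
  -- By Abel's identity the Wronskian is `k z^(-c) (1-z)^(-d)`, so `(y₂/y₁)' = k z^(-c) h` with this
  -- `h`. The equation solved by `H` makes `z^(1-c) H` a primitive of `z^(-c) h`.
  have hh : AnalyticAt ℂ (fun z => (1 - z) ^ (-d) * (y₁ z ^ 2)⁻¹) 0 := by
    refine AnalyticAt.mul ?_ ((h0.pow 2).inv (by simp [h₁0]))
    exact (analyticAt_const.sub analyticAt_id).cpow analyticAt_const (by simp)
  obtain ⟨H, hH, hHd⟩ := exists_analyticAt_euler_eq hh hc
  have hne : ∀ᶠ z in 𝓝 (0 : ℂ), y₁ z ≠ 0 :=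
    h0.continuousAt.eventually_ne (by simp [h₁0])
  obtain ⟨ρ, hρ, hball⟩ := Metric.eventually_nhds_iff_ball.1
    ((hHd.and hne).and (Metric.ball_mem_nhds (0 : ℂ) hr))
  set U : Set ℂ := Metric.ball 0 ρ ∩ Complex.slitPlane with hU
  have hUo : IsOpen U := Metric.isOpen_ball.inter Complex.isOpen_slitPlane
  -- The slit disc is star-shaped about the positive real `ρ/2`; connectedness makes functions with
  -- zero derivative constant.
  have hUc : IsPreconnected U := by
    have hx : (0 : ℝ) < ρ / 2 := by positivity
    have hxm : ((ρ / 2 : ℝ) : ℂ) ∈ Metric.ball (0 : ℂ) ρ := by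
      rw [mem_ball_zero_iff, Complex.norm_real, Real.norm_of_nonneg hx.le]
      linarith
    exact ((((convex_ball (0 : ℂ) ρ).starConvex hxm).inter
      (Complex.starConvex_ofReal_slitPlane hx)).isPathConnected
      ⟨hxm, Complex.ofReal_mem_slitPlane.2 hx⟩).isConnected.isPreconnected
  have hU1 : ∀ z ∈ U, z ≠ 0 ∧ 1 - z ≠ 0 ∧ 1 - z ∈ Complex.slitPlane := by
    intro z hz
    have h1 : ‖z‖ < 1 := by
      have := mem_ball_zero_iff.1 (hball z hz.1).2
      linarith
    have h2 : 1 - z ∈ Complex.slitPlane := ball_subset_slitAtOne (by simpa using h1)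
    exact ⟨Complex.slitPlane_ne_zero hz.2, Complex.slitPlane_ne_zero h2, h2⟩
  set W : ℂ → ℂ := fun z => y₁ z * deriv y₂ z - deriv y₁ z * y₂ z with hW
  have hWd : ∀ z ∈ U, HasDerivAt W (y₁ z * deriv (deriv y₂) z - deriv (deriv y₁) z * y₂ z) z := by
    intro z hz
    have b1 := hA₁ z (hball z hz.1).2
    have b2 := hA₂ z hz.2
    refine ((b1.differentiableAt.hasDerivAt.mul b2.deriv.differentiableAt.hasDerivAt).sub
      (b1.deriv.differentiableAt.hasDerivAt.mul b2.differentiableAt.hasDerivAt)).congr_deriv ?_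
    ring
  have hpow : ∀ z ∈ U, ∀ s : ℂ, HasDerivAt (fun z : ℂ => z ^ s) (s * (z ^ s / z)) z := by
    intro z hz s
    refine ((hasDerivAt_id z).cpow_const (c := s) hz.2).congr_deriv ?_
    simp only [id]
    rw [Complex.cpow_sub _ _ (hU1 z hz).1, Complex.cpow_one]
    ring
  have hpow' : ∀ z ∈ U, HasDerivAt (fun z : ℂ => (1 - z) ^ d) (-(d * ((1 - z) ^ d / (1 - z)))) z := by
    intro z hz
    refine (((hasDerivAt_id z).const_sub 1).cpow_const (c := d) (hU1 z hz).2.2).congr_deriv ?_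
    simp only [id]
    rw [Complex.cpow_sub _ _ (hU1 z hz).2.1, Complex.cpow_one]
    ring
  -- Abel's identity: eliminating the second derivatives through both equations leaves zero.
  have hM : ∀ z ∈ U, HasDerivAt (fun z : ℂ => z ^ (c : ℂ) * (1 - z) ^ d * W z) 0 z := by
    intro z hz
    refine (((hpow z hz c).fun_mul (hpow' z hz)).fun_mul (hWd z hz)).congr_deriv ?_
    obtain ⟨z0, z1, -⟩ := hU1 z hz
    have o1 := ode₁ z (hball z hz.1).2
    have o2 := ode₂ z hz.2
    simp only [gaussOp] at o1 o2
    simp only [hW]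
    field_simp
    rw [hd]
    linear_combination z ^ (c : ℂ) * (1 - z) ^ (a + b + 1 - c : ℂ) * (y₁ z * o2 - y₂ z * o1)
  obtain ⟨k, hk⟩ := hUo.exists_is_const_of_deriv_eq_zero hUc
    (fun z hz => (hM z hz).differentiableAt.differentiableWithinAt) (fun z hz => (hM z hz).deriv)
  have hN : ∀ z ∈ U, HasDerivAt
      (fun z : ℂ => y₂ z / y₁ z - k * (z ^ (1 - (c : ℂ)) * H z)) 0 z := by
    intro z hz
    have b1 := hA₁ z (hball z hz.1).2
    have b2 := hA₂ z hz.2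
    obtain ⟨⟨⟨hH1, hH2⟩, y0⟩, -⟩ := hball z hz.1
    obtain ⟨z0, z1, -⟩ := hU1 z hz
    refine ((b2.differentiableAt.hasDerivAt.div b1.differentiableAt.hasDerivAt y0).sub
      (((hpow z hz (1 - c)).fun_mul hH1).const_mul k)).congr_deriv ?_
    have hkz := hk z hz
    simp only [hW] at hkz
    have c1 : z ^ (1 - (c : ℂ)) * z ^ (c : ℂ) = z := by
      rw [← Complex.cpow_add _ _ z0]; simp
    have c2 : (1 - z) ^ (-d) * (1 - z) ^ d = 1 := by
      rw [← Complex.cpow_add _ _ z1]; simp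
    have zc : z ^ (c : ℂ) ≠ 0 := by simp [Complex.cpow_eq_zero_iff, z0]
    have zd : (1 - z) ^ d ≠ 0 := by simp [Complex.cpow_eq_zero_iff, z1]
    have c1' : z ^ (1 - (c : ℂ)) = z / z ^ (c : ℂ) := eq_div_of_mul_eq zc c1
    have c2' : (1 - z) ^ (-d) = 1 / (1 - z) ^ d := eq_div_of_mul_eq zd c2
    rw [c2'] at hH2
    rw [c1', ← hkz]
    field_simp at hH2 ⊢
    linear_combination (-(y₁ z * deriv y₂ z - deriv y₁ z * y₂ z)) * hH2
  obtain ⟨A, hA⟩ := hUo.exists_is_const_of_deriv_eq_zero hUc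
    (fun z hz => (hN z hz).differentiableAt.differentiableWithinAt) (fun z hz => (hN z hz).deriv)
  refine ⟨A, fun z => k * H z * y₁ z, (analyticAt_const.mul hH).mul h0, ?_⟩
  filter_upwards [Metric.ball_mem_nhds (0 : ℂ) hρ] with z hz hzs
  have h1 := hA z ⟨hz, hzs⟩
  have y0 := (hball z hz).1.2
  rw [← h1]
  field_simp
  ring

/-- The connection formula at `0` for the solution that is regular at `1`. -/
theorem exists_connection (ha : 0 < a) (hb : 0 < b) (hbc : b < c) (hc : c < 1) :
    ∃ H : ℂ → ℂ, AnalyticAt ℂ H 0 ∧ ∀ᶠ z in 𝓝 (0 : ℂ), z ∈ Complex.slitPlane →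
      gaussContinuation a b ((a + b + 1 - c : ℝ) : ℂ) (1 - z) =
        ((beta b (1 - c) / beta b (a + 1 - c) : ℝ) : ℂ) * gaussContinuation a b c z +
          z ^ (1 - (c : ℂ)) * H z := by
  have hbc' : b < a + b + 1 - c := by linarith
  have hG₁ := isGaussContinuation_gaussContinuation ha hb hbc
  have hG₂ := isGaussContinuation_gaussContinuation ha hb hbc'
  set y₁ := gaussContinuation (a : ℂ) b c with hy₁
  set G := gaussContinuation (a : ℂ) b ((a + b + 1 - c : ℝ) : ℂ) with hG
  have hm : ∀ z ∈ Complex.slitPlane, 1 - z ∈ slitAtOne := by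
    intro z hz
    have : 1 - (1 - z) ∈ Complex.slitPlane := by rwa [sub_sub_cancel]
    exact this
  have hGd := hG₂.1.analyticOnNhd isOpen_slitAtOne
  have hs : ∀ z : ℂ, HasDerivAt (fun z : ℂ => 1 - z) (-1) z := fun z => by
    simpa using (hasDerivAt_id z).const_sub 1
  have hd1 : ∀ z ∈ Complex.slitPlane,
      HasDerivAt (fun z => G (1 - z)) (-deriv G (1 - z)) z := by
    intro z hz
    simpa [Function.comp_def] using (hGd _ (hm z hz)).differentiableAt.hasDerivAt.comp z (hs z)
  have hd2 : ∀ z ∈ Complex.slitPlane,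
      deriv (deriv fun z => G (1 - z)) z = deriv (deriv G) (1 - z) := by
    intro z hz
    have h1 : deriv (fun z => G (1 - z)) =ᶠ[𝓝 z] fun z => -deriv G (1 - z) := by
      filter_upwards [Complex.isOpen_slitPlane.mem_nhds hz] with w hw using (hd1 w hw).deriv
    rw [h1.deriv_eq]
    have h2 := ((hGd _ (hm z hz)).deriv.differentiableAt.hasDerivAt.comp z (hs z)).neg
    have h3 : HasDerivAt (fun z => -deriv G (1 - z)) (deriv (deriv G) (1 - z)) z := by
      simpa [Function.comp_def, Pi.neg_def] using h2
    exact h3.deriv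
  have h₁0 : y₁ 0 = 1 := by
    rw [hG₁.2 0 (by simp), ordinaryHypergeometric_zero]
  -- The substitution `z ↦ 1 - z` exchanges the equations with third parameters `c` and `a + b + 1 -
  -- c`.
  obtain ⟨A, H, hH, hev⟩ := exists_eq_add_cpow_mul (a := a) (b := b) (c := c) (y₁ := y₁)
    (y₂ := fun z => G (1 - z)) one_pos le_rfl hc (hG₁.1.mono ball_subset_slitAtOne) h₁0
    (fun z hz => (hd1 z hz).differentiableAt.differentiableWithinAt)
    (fun z hz => gaussOp_gaussContinuation ha hb hbc (ball_subset_slitAtOne hz))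
    (fun z hz => by
      have := gaussOp_gaussContinuation ha hb hbc' (hm z hz)
      rw [← hG] at this
      clear_value G
      simp only [gaussOp] at this ⊢
      rw [hd2 z hz, (hd1 z hz).deriv]
      push_cast at this
      linear_combination this)
  refine ⟨H, hH, ?_⟩
  -- Let `z → 0` along the positive reals: `z^(1-c) H` vanishes because `c < 1`, `y₁ → 1`, and
  -- Gauss's theorem gives the limit of the left side.
  have hAval : A = ((beta b (1 - c) / beta b (a + 1 - c) : ℝ) : ℂ) := by
    have l1 := tendsto_gaussContinuation_one ha hb hbc' (by linarith)
    rw [show a + b + 1 - c - a - b = 1 - c by ring, show a + b + 1 - c - b = a + 1 - c by ring,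
      ← hG] at l1
    have l0 : Tendsto (fun x : ℝ => (x : ℂ)) (𝓝[>] 0) (𝓝 0) :=
      (Complex.continuous_ofReal.tendsto' 0 0 (by simp)).mono_left nhdsWithin_le_nhds
    have l2 : Tendsto (fun x : ℝ => A * y₁ x + (x : ℂ) ^ (1 - (c : ℂ)) * H x) (𝓝[>] 0)
        (𝓝 (A * 1 + 0 * H 0)) := by
      refine Tendsto.add (Tendsto.const_mul _ ?_) (Tendsto.mul ?_ (hH.continuousAt.tendsto.comp l0))
      · have : ContinuousAt y₁ 0 := (hG₁.1.differentiableAt (isOpen_slitAtOne.mem_nhds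
          (ball_subset_slitAtOne (Metric.mem_ball_self one_pos)))).continuousAt
        rw [← h₁0]
        exact this.tendsto.comp l0
      · have hc' : 0 < 1 - c := sub_pos.2 hc
        have h1 : Tendsto (fun x : ℝ => ((x ^ (1 - c) : ℝ) : ℂ)) (𝓝[>] 0) (𝓝 0) := by
          have h2 : Tendsto (fun x : ℝ => x ^ (1 - c)) (𝓝[>] 0) (𝓝 0) := by
            have := (Real.continuousAt_rpow_const 0 (1 - c) (.inr hc'.le)).tendsto
            rw [Real.zero_rpow hc'.ne'] at this
            exact this.mono_left nhdsWithin_le_nhds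
          exact (Complex.continuous_ofReal.tendsto' 0 0 (by simp)).comp h2
        refine h1.congr' ?_
        filter_upwards [self_mem_nhdsWithin] with x hx
        rw [Complex.ofReal_cpow (le_of_lt hx)]
        push_cast
        rfl
    have l3 : Tendsto (fun x : ℝ => G (1 - x)) (𝓝[>] 0) (𝓝 (A * 1 + 0 * H 0)) := by
      refine l2.congr' ?_
      filter_upwards [l0.eventually hev, self_mem_nhdsWithin] with x hx hx0
      exact (hx (Complex.ofReal_mem_slitPlane.2 hx0)).symm
    have := tendsto_nhds_unique l3 l1
    simpa using this
  rw [← hAval]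
  exact hev

end ThreeCone

end

noncomputable section

namespace ThreeCone

open MeasureTheory Set ProbabilityTheory

/-! ### The constants -/

/-- The connection coefficient `Γ(1-c) Γ(a+b+1-c) / (Γ(a+1-c) Γ(b+1-c))`. -/
def connCoeff (a b c : ℝ) : ℝ :=
  Real.Gamma (1 - c) * Real.Gamma (a + b + 1 - c) / (Real.Gamma (a + 1 - c) * Real.Gamma (b + 1 - c))

section

variable {a b c : ℝ}

lemma beta_div_beta (hb : 0 < b) (hac : 0 < a + 1 - c) (hbc : 0 < b + 1 - c) :
    beta b (1 - c) / beta b (a + 1 - c) = connCoeff a b c := by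
  have h1 := Real.Gamma_pos_of_pos hb
  have h2 := Real.Gamma_pos_of_pos hac
  have h3 := Real.Gamma_pos_of_pos hbc
  rw [beta, beta, connCoeff, show b + (1 - c) = b + 1 - c by ring,
    show b + (a + 1 - c) = a + b + 1 - c by ring]
  field_simp

lemma Gamma_reflection {s : ℝ} (h0 : 0 < s) (h1 : s < 1) :
    0 < Real.Gamma s ∧ 0 < Real.Gamma (1 - s) ∧ 0 < Real.sin (Real.pi * s) ∧
      Real.Gamma s * Real.Gamma (1 - s) * Real.sin (Real.pi * s) = Real.pi := by
  have hs : 0 < Real.sin (Real.pi * s) := by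
    refine Real.sin_pos_of_pos_of_lt_pi (by positivity) ?_
    nlinarith [Real.pi_pos]
  refine ⟨Real.Gamma_pos_of_pos h0, Real.Gamma_pos_of_pos (sub_pos.2 h1), hs, ?_⟩
  rw [Real.Gamma_mul_Gamma_one_sub]
  field_simp

lemma sin_identity (x y z : ℝ) :
    Real.sin (z - x) * Real.sin (z - y) - Real.sin z * Real.sin (z - x - y) =
      Real.sin x * Real.sin y := by
  rw [show z - x - y = z - (x + y) by ring]
  simp only [Real.sin_sub, Real.sin_add, Real.cos_add]
  linear_combination (Real.sin x * Real.sin y) * Real.sin_sq_add_cos_sq z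

/-- The factor `sin πa sin πb / (sin π(c-a) sin π(c-b))`. -/
def sinRatio (a b c : ℝ) : ℝ :=
  Real.sin (Real.pi * a) * Real.sin (Real.pi * b) /
    (Real.sin (Real.pi * (c - a)) * Real.sin (Real.pi * (c - b)))

lemma sinRatio_pos (ha : 0 < a) (hb : 0 < b) (hac : a < c) (hbc : b < c) (hc : c < 1) :
    0 < sinRatio a b c := by
  have h1 := (Gamma_reflection ha (hac.trans hc)).2.2.1
  have h2 := (Gamma_reflection hb (hbc.trans hc)).2.2.1
  have h3 := (Gamma_reflection (sub_pos.2 hac) (by linarith)).2.2.1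
  have h4 := (Gamma_reflection (sub_pos.2 hbc) (by linarith)).2.2.1
  rw [sinRatio]
  positivity

lemma connCoeff_pos (ha : 0 < a) (hb : 0 < b) (hc : c < 1) : 0 < connCoeff a b c := by
  have h1 := Real.Gamma_pos_of_pos (sub_pos.2 hc)
  have h2 := Real.Gamma_pos_of_pos (by linarith : 0 < a + b + 1 - c)
  have h3 := Real.Gamma_pos_of_pos (by linarith : 0 < a + 1 - c)
  have h4 := Real.Gamma_pos_of_pos (by linarith : 0 < b + 1 - c)
  rw [connCoeff]
  positivity

/-- By reflection, the first term is `-A sin(πc) sin(π(c-a-b)) / (sin(π(c-a)) sin(π(c-b)))` with `A`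
the connection coefficient; `sin_identity` then collapses the sum. -/
lemma neg_add_connCoeff (ha : 0 < a) (hb : 0 < b) (habc : a + b < c) (hc : c < 1) :
    -(Real.Gamma (c - a) * Real.Gamma (c - b) / (Real.Gamma c * Real.Gamma (c - a - b))) +
      connCoeff a b c = connCoeff a b c * sinRatio a b c := by
  obtain ⟨p1, q1, s1, e1⟩ := Gamma_reflection (s := c - a) (by linarith) (by linarith)
  obtain ⟨p2, q2, s2, e2⟩ := Gamma_reflection (s := c - b) (by linarith) (by linarith)
  obtain ⟨p3, q3, s3, e3⟩ := Gamma_reflection (s := c) (by linarith) hc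
  obtain ⟨p4, q4, s4, e4⟩ := Gamma_reflection (s := c - a - b) (by linarith) (by linarith)
  have hs := sin_identity (Real.pi * a) (Real.pi * b) (Real.pi * c)
  simp only [← mul_sub] at hs
  rw [connCoeff, sinRatio, ← hs, show a + b + 1 - c = 1 - (c - a - b) by ring,
    show a + 1 - c = 1 - (c - a) by ring, show b + 1 - c = 1 - (c - b) by ring]
  generalize Real.Gamma (c - a) = g1 at *
  generalize Real.Gamma (1 - (c - a)) = g1' at *
  generalize Real.Gamma (c - b) = g2 at *
  generalize Real.Gamma (1 - (c - b)) = g2' at *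
  generalize Real.Gamma c = g3 at *
  generalize Real.Gamma (1 - c) = g3' at *
  generalize Real.Gamma (c - a - b) = g4 at *
  generalize Real.Gamma (1 - (c - a - b)) = g4' at *
  generalize Real.sin (Real.pi * (c - a)) = t1 at *
  generalize Real.sin (Real.pi * (c - b)) = t2 at *
  generalize Real.sin (Real.pi * c) = t3 at *
  generalize Real.sin (Real.pi * (c - a - b)) = t4 at *
  have key : (g1 * g1' * t1) * (g2 * g2' * t2) = (g3 * g3' * t3) * (g4 * g4' * t4) := by
    rw [e1, e2, e3, e4]
  field_simp
  linear_combination -key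

lemma sqrt_sinRatio_mul_sqrt (ha : 0 < a) (hb : 0 < b) (hac : a < c) (hbc : b < c) (hc : c < 1) :
    Real.sqrt (sinRatio a b c) *
      Real.sqrt ((Real.Gamma (1 - a) * Real.Gamma (1 - b) * Real.Gamma (a + 1 - c) *
        Real.Gamma (b + 1 - c)) /
      (Real.Gamma a * Real.Gamma b * Real.Gamma (c - a) * Real.Gamma (c - b))) =
    Real.Gamma (a + 1 - c) * Real.Gamma (b + 1 - c) / (Real.Gamma a * Real.Gamma b) := by
  rw [← Real.sqrt_mul (sinRatio_pos ha hb hac hbc hc).le]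
  obtain ⟨p1, q1, s1, e1⟩ := Gamma_reflection (s := c - a) (by linarith) (by linarith)
  obtain ⟨p2, q2, s2, e2⟩ := Gamma_reflection (s := c - b) (by linarith) (by linarith)
  obtain ⟨p3, q3, s3, e3⟩ := Gamma_reflection ha (by linarith)
  obtain ⟨p4, q4, s4, e4⟩ := Gamma_reflection hb (by linarith)
  rw [sinRatio, show a + 1 - c = 1 - (c - a) by ring, show b + 1 - c = 1 - (c - b) by ring]
  generalize Real.Gamma (c - a) = g1 at *
  generalize Real.Gamma (1 - (c - a)) = g1' at *
  generalize Real.Gamma (c - b) = g2 at *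
  generalize Real.Gamma (1 - (c - b)) = g2' at *
  generalize Real.Gamma a = g3 at *
  generalize Real.Gamma (1 - a) = g3' at *
  generalize Real.Gamma b = g4 at *
  generalize Real.Gamma (1 - b) = g4' at *
  generalize Real.sin (Real.pi * (c - a)) = t1 at *
  generalize Real.sin (Real.pi * (c - b)) = t2 at *
  generalize Real.sin (Real.pi * a) = t3 at *
  generalize Real.sin (Real.pi * b) = t4 at *
  have key : (g1 * g1' * t1) * (g2 * g2' * t2) = (g3 * g3' * t3) * (g4 * g4' * t4) := by
    rw [e1, e2, e3, e4]
  -- By reflection the product of the two radicands is a perfect square, free of sines.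
  have h : t3 * t4 / (t1 * t2) * (g3' * g4' * g1' * g2' / (g3 * g4 * g1 * g2)) =
      (g1' * g2' / (g3 * g4)) ^ 2 := by
    field_simp
    linear_combination -key
  rw [h, Real.sqrt_sq (by positivity)]

end

section

variable {α β γ : ℝ}

lemma K₂_eq (α β γ : ℝ) : K₂ α β γ = -(connCoeff (parA α β γ) (parB α β γ) α)⁻¹ := by
  simp only [K₂, connCoeff, inv_div]

lemma K₁_add_connCoeff (hβ₁ : β < 1) (hα₁ : α < 1) (ha : 0 < parA α β γ) (hb : 0 < parB α β γ) :
    K₁ α β γ + connCoeff (parA α β γ) (parB α β γ) α =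
      connCoeff (parA α β γ) (parB α β γ) α * sinRatio (parA α β γ) (parB α β γ) α :=
  neg_add_connCoeff ha hb (by rw [parA, parB]; linarith) hα₁

/-- The factor `Γ(a+b+1-c)` cancels, one square root of `sinRatio` remains in the denominator and is
absorbed by `sqrt_sinRatio_mul_sqrt`; `1 - α` comes from `Γ(2-α) = (1-α) Γ(1-α)`. -/
lemma K₃_div_eq (hα₁ : α < 1) (ha : 0 < parA α β γ) (hb : 0 < parB α β γ)
    (haα : parA α β γ < α) (hbα : parB α β γ < α) :
    K₃ α β γ / (connCoeff (parA α β γ) (parB α β γ) α * sinRatio (parA α β γ) (parB α β γ) α) =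
      delta α β γ * (1 - α) := by
  simp only [K₃, delta]
  generalize parA α β γ = a at *
  generalize parB α β γ = b at *
  have hS := sinRatio_pos ha hb haα hbα hα₁
  have key := sqrt_sinRatio_mul_sqrt ha hb haα hbα hα₁
  rw [show (2 : ℝ) - α = (1 - α) + 1 by ring, Real.Gamma_add_one (by linarith)]
  change Real.sqrt (sinRatio a b α) * _ / _ = _
  have p1 := Real.Gamma_pos_of_pos (sub_pos.2 hα₁)
  have p2 := Real.Gamma_pos_of_pos (by linarith : 0 < a + b + 1 - α)
  have p3 := Real.Gamma_pos_of_pos (by linarith : 0 < a + 1 - α)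
  have p4 := Real.Gamma_pos_of_pos (by linarith : 0 < b + 1 - α)
  have p5 := Real.Gamma_pos_of_pos ha
  have p6 := Real.Gamma_pos_of_pos hb
  have h1 : 0 < 1 - α := sub_pos.2 hα₁
  have hsq := Real.mul_self_sqrt hS.le
  have hsp := Real.sqrt_pos.2 hS
  rw [connCoeff]
  generalize Real.sqrt (_ / (Real.Gamma a * Real.Gamma b * _ * _)) = T at *
  nth_rewrite 2 [← hsq]
  generalize Real.sqrt (sinRatio a b α) = S at *
  field_simp at key ⊢
  linear_combination (-Real.Gamma α) * key

/-! ### The density near the origin -/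

lemma phi₁_eq {z : ℂ} (hz : ‖z‖ < 1) :
    phi₁ α β γ z = gaussContinuation (parA α β γ) (parB α β γ) α z := by
  rw [phi₁, F, if_pos (ball_subset_slitAtOne (by simpa using hz))]

lemma phi₂_eq_of_mem {z : ℂ} (hz : z ∈ Complex.slitPlane) :
    phi₂ α β γ z = gaussContinuation (parA α β γ) (parB α β γ)
      ((parA α β γ + parB α β γ + 1 - α : ℝ) : ℂ) (1 - z) := by
  have h : 1 - z ∈ slitAtOne := by
    have : 1 - (1 - z) ∈ Complex.slitPlane := by rwa [sub_sub_cancel]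
    exact this
  rw [phi₂, F, if_pos h]
  congr 1
  push_cast
  ring

/-- The principal argument is `π` on the negative axis, hence continuous from above. This matches
the convention for `F`: as `w` tends to the cut from below, `1 - w` tends to the negative axis from
above. -/
lemma continuousWithinAt_cpow_upper {z : ℂ} (hz : z ≠ 0) (hz' : z ∉ Complex.slitPlane) (s : ℂ) :
    ContinuousWithinAt (fun w : ℂ => w ^ s) {w | 0 < w.im} z := by
  rw [Complex.mem_slitPlane_iff] at hz'
  push Not at hz'
  have hre : z.re < 0 := by
    refine lt_of_le_of_ne hz'.1 fun h => hz (Complex.ext h hz'.2)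
  have h1 : ContinuousWithinAt (fun w : ℂ => Complex.exp (Complex.log w * s)) {w | 0 < w.im} z :=
    Complex.continuous_exp.continuousAt.comp_continuousWithinAt
      (((Complex.continuousWithinAt_log_of_re_neg_of_im_zero hre hz'.2).mono
        fun w (hw : 0 < w.im) => hw.le).mul continuousWithinAt_const)
  refine h1.congr (fun w (hw : 0 < w.im) => ?_) (Complex.cpow_def_of_ne_zero hz _)
  have hw0 : w ≠ 0 := fun h => by simp [h] at hw
  exact Complex.cpow_def_of_ne_zero hw0 _

/-- The behaviour of `φ₂` at the origin, with the principal power, including the cut. -/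
lemma exists_phi₂_eq (hα₁ : α < 1) (ha : 0 < parA α β γ) (hb : 0 < parB α β γ)
    (hbα : parB α β γ < α) :
    ∃ H : ℂ → ℂ, AnalyticAt ℂ H 0 ∧ ∀ᶠ z in 𝓝[≠] (0 : ℂ),
      phi₂ α β γ z = (connCoeff (parA α β γ) (parB α β γ) α : ℂ) * phi₁ α β γ z +
        z ^ ((1 - α : ℝ) : ℂ) * H z := by
  obtain ⟨H, hH, hev⟩ := exists_connection ha hb hbα hα₁
  rw [beta_div_beta hb (by linarith) (by linarith)] at hev
  have hG₁ := isGaussContinuation_gaussContinuation ha hb hbα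
  refine ⟨H, hH, ?_⟩
  filter_upwards [nhdsWithin_le_nhds hev.eventually_nhds,
    nhdsWithin_le_nhds hH.eventually_analyticAt,
    nhdsWithin_le_nhds (Metric.ball_mem_nhds (0 : ℂ) one_pos), self_mem_nhdsWithin]
    with z h1 h2 h3 h4
  have hz0 : z ≠ 0 := h4
  have hz1 : ‖z‖ < 1 := by simpa using h3
  rw [phi₁_eq hz1]
  push_cast
  by_cases hz : z ∈ Complex.slitPlane
  · rw [phi₂_eq_of_mem hz]
    exact h1.self_of_nhds hz
  · have hns : 1 - z ∉ slitAtOne := by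
      intro h
      have : 1 - (1 - z) ∈ Complex.slitPlane := h
      rw [sub_sub_cancel] at this
      exact hz this
    rw [phi₂, F, if_neg hns]
    have hcw : ContinuousWithinAt (fun w : ℂ =>
        (connCoeff (parA α β γ) (parB α β γ) α : ℂ) *
          gaussContinuation (parA α β γ) (parB α β γ) α w + w ^ (1 - (α : ℂ)) * H w)
        {w | 0 < w.im} z := by
      have hc1 : ContinuousAt (gaussContinuation (parA α β γ) (parB α β γ) (α : ℂ)) z :=
        (hG₁.1.differentiableAt (isOpen_slitAtOne.mem_nhds (ball_subset_slitAtOne h3))).continuousAt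
      exact (continuousWithinAt_const.mul hc1.continuousWithinAt).add
        ((continuousWithinAt_cpow_upper hz0 hz _).mul h2.continuousAt.continuousWithinAt)
    have hsub : Tendsto (fun w : ℂ => 1 - w) (𝓝[{w : ℂ | w.im < 0}] (1 - z))
        (𝓝[{w : ℂ | 0 < w.im}] z) := by
      refine tendsto_nhdsWithin_iff.2 ⟨?_, ?_⟩
      · have : ContinuousAt (fun w : ℂ => 1 - w) (1 - z) := by fun_prop
        have h := this.tendsto
        rw [sub_sub_cancel] at h
        exact h.mono_left nhdsWithin_le_nhds
      · filter_upwards [self_mem_nhdsWithin] with w hw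
        have hw : w.im < 0 := hw
        simpa using hw
    have him : (1 - z).im = 0 := by
      rw [Complex.mem_slitPlane_iff] at hz
      push Not at hz
      simp [hz.2]
    -- The cut lies in the closure of the lower half-plane, so the limit defining `F` there is
    -- unique.
    have : (𝓝[{w : ℂ | w.im < 0}] (1 - z)).NeBot := by
      rw [← mem_closure_iff_nhdsWithin_neBot, Complex.closure_setOfPred_im_lt]
      exact him.le
    refine Tendsto.limUnder_eq ((hcw.tendsto.comp hsub).congr' ?_)
    filter_upwards [(hsub.mono_right nhdsWithin_le_nhds).eventually h1, self_mem_nhdsWithin]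
      with w hw1 hw2
    have hw2 : w.im < 0 := hw2
    have hw3 : 1 - w ∈ Complex.slitPlane := by
      rw [Complex.mem_slitPlane_iff]
      right
      simpa using hw2.ne
    have h := hw1 hw3
    rw [sub_sub_cancel] at h
    simp only [Function.comp_apply]
    rw [← h]
    congr 1
    push_cast
    ring

/-- Off the cut, `φ₂(z̄)` is the conjugate of `φ₂(z)`. On the cut that symmetry is not available,
but `z̄ = z` and `φ₁(z)` is real, so only the real part of `φ₂(z)` enters. -/
lemma re_phi₁_mul_phi₂_conj (hα₁ : α < 1) (ha : 0 < parA α β γ) (hb : 0 < parB α β γ)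
    (hbα : parB α β γ < α) {z : ℂ} (hz1 : ‖z‖ < 1) :
    (phi₁ α β γ z * phi₂ α β γ (conj z)).re = (phi₁ α β γ z * conj (phi₂ α β γ z)).re := by
  by_cases hz : z ∈ Complex.slitPlane
  · have hzc : conj z ∈ Complex.slitPlane := by
      rw [Complex.mem_slitPlane_iff] at hz ⊢
      simpa using hz
    have hm : 1 - z ∈ slitAtOne := by
      have : 1 - (1 - z) ∈ Complex.slitPlane := by rwa [sub_sub_cancel]
      exact this
    rw [phi₂_eq_of_mem hz, phi₂_eq_of_mem hzc,
      ← gaussContinuation_conj ha hb (by linarith) hm, map_sub, map_one]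
  · rw [Complex.mem_slitPlane_iff] at hz
    push Not at hz
    have hcz : conj z = z := Complex.conj_eq_iff_im.2 hz.2
    have h : phi₁ α β γ z = conj (phi₁ α β γ z) := by
      rw [phi₁_eq hz1, ← gaussContinuation_conj ha hb hbα
        (ball_subset_slitAtOne (by simpa using hz1)), hcz]
    have him := Complex.conj_eq_iff_im.1 h.symm
    rw [hcz]
    simp [Complex.mul_re, him]

lemma eventually_contDiffAt_of_analyticAt {f : ℂ → ℂ} (hf : AnalyticAt ℂ f 0) :
    ∀ᶠ z in 𝓝 (0 : ℂ), ContDiffAt ℝ ∞ f z := by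
  filter_upwards [hf.eventually_analyticAt] with z hz
  exact hz.contDiffAt.restrict_scalars ℝ

lemma tame_mul_conj {f : ℂ → ℂ} (hf : AnalyticAt ℂ f 0) :
    Tame (fun z => f z * conj (f z)) (f 0 * conj (f 0)) := by
  refine tame_of_contDiffAt (f := fun z => f z * conj (f z)) ?_
  filter_upwards [eventually_contDiffAt_of_analyticAt hf] with z hz
  exact hz.mul ((contDiffAt_conj (f z)).comp z hz)

lemma tame_norm_one_sub_rpow (s : ℝ) : Tame (fun z => absPow s (1 - z)) 1 := by
  have h : Tame (fun z => absPow s (1 - z)) (absPow s (1 - 0)) := by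
    refine tame_of_contDiffAt (f := fun z => absPow s (1 - z)) ?_
    filter_upwards [Metric.ball_mem_nhds (0 : ℂ) one_pos] with z hz
    have hz : ‖z‖ < 1 := by simpa using hz
    have hne : 1 - z ≠ 0 := by
      intro h
      rw [← sub_eq_zero.1 h] at hz
      simp at hz
    exact (contDiffAt_absPow s hne).comp z (contDiffAt_const.sub contDiffAt_id)
  simpa [absPow] using h

/-- Near the origin the density is `|z|^(-α)` times a tame function. -/
lemma exists_tame_density (hα₁ : α < 1) (hβ₁ : β < 1) (ha : 0 < parA α β γ)
    (hb : 0 < parB α β γ) (haα : parA α β γ < α) (hbα : parB α β γ < α) :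
    ∃ g : ℂ → ℂ, Tame g ((delta α β γ * (1 - α) : ℝ) : ℂ) ∧
      (fun z => (density α β γ z : ℂ)) =ᶠ[𝓝[≠] 0] fun z => absPow (-α) z * g z := by
  obtain ⟨H, hH, hev⟩ := exists_phi₂_eq hα₁ ha hb hbα
  set A := connCoeff (parA α β γ) (parB α β γ) α with hA
  have hApos : 0 < A := connCoeff_pos ha hb hα₁
  set P := A * sinRatio (parA α β γ) (parB α β γ) α with hP
  have hPpos : 0 < P := mul_pos hApos (sinRatio_pos ha hb haα hbα hα₁)
  have hK₁ : K₁ α β γ + A = P := K₁_add_connCoeff hβ₁ hα₁ ha hb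
  have hG₁ := isGaussContinuation_gaussContinuation ha hb hbα
  set y := gaussContinuation (parA α β γ) (parB α β γ) (α : ℂ) with hy
  have hyA : AnalyticAt ℂ y 0 := hG₁.1.analyticOnNhd isOpen_slitAtOne 0
    (ball_subset_slitAtOne (Metric.mem_ball_self one_pos))
  have hy0 : y 0 = 1 := by
    rw [hG₁.2 0 (by simp), ordinaryHypergeometric_zero]
  -- The denominator in its final form. The exponent `2(1-α)` is positive, so the second term is
  -- tame with limit `0` and the whole tends to `P`.
  have hD := ((tame_const (P : ℂ)).mul (tame_mul_conj hyA)).add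
    ((tame_const (-(A⁻¹ : ℝ) : ℂ)).mul
      ((tame_absPow (s := 2 * (1 - α)) (by linarith)).mul (tame_mul_conj hH)))
  simp only [hy0, map_one, mul_one, zero_mul, mul_zero, add_zero] at hD
  have hg := (tame_norm_one_sub_rpow (-β)).mul ((tame_const (K₃ α β γ : ℂ)).mul
    (hD.inv (Complex.ofReal_ne_zero.2 hPpos.ne')))
  have hl : (1 : ℂ) * ((K₃ α β γ : ℂ) * (P : ℂ)⁻¹) = ((delta α β γ * (1 - α) : ℝ) : ℂ) := by
    rw [← K₃_div_eq hα₁ ha hb haα hbα, hP]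
    push_cast
    ring
  refine ⟨_, hl ▸ hg, ?_⟩
  filter_upwards [hev, nhdsWithin_le_nhds (Metric.ball_mem_nhds (0 : ℂ) one_pos),
    self_mem_nhdsWithin] with z h1 h2 h3
  have hz0 : z ≠ 0 := h3
  have hz1 : ‖z‖ < 1 := by simpa using h2
  have hzpos := norm_pos_iff.2 hz0
  have hden : K₁ α β γ * ‖phi₁ α β γ z‖ ^ 2 + K₂ α β γ * ‖phi₂ α β γ z‖ ^ 2 +
      2 * (phi₁ α β γ z * phi₂ α β γ (conj z)).re =
      P * ‖y z‖ ^ 2 - A⁻¹ * (‖z‖ ^ (2 * (1 - α)) * ‖H z‖ ^ 2) := by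
    rw [re_phi₁_mul_phi₂_conj hα₁ ha hb hbα hz1, h1, phi₁_eq hz1, ← hy, K₂_eq, ← hA, ← hK₁]
    have hη : ‖z‖ ^ (2 * (1 - α)) * ‖H z‖ ^ 2 = ‖z ^ ((1 - α : ℝ) : ℂ) * H z‖ ^ 2 := by
      rw [norm_mul, Complex.norm_cpow_real, mul_pow, ← Real.rpow_natCast (‖z‖ ^ (1 - α)),
        ← Real.rpow_mul hzpos.le]
      congr 2
      push_cast
      ring
    rw [hη]
    -- With `φ₂ = Aφ₁ + η` and `K₂ = -1/A`, the cross terms `∓2 Re(φ₁ η̄)` cancel; this is an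
    -- identity for arbitrary `η`.
    generalize z ^ ((1 - α : ℝ) : ℂ) * H z = η
    simp only [← Complex.normSq_eq_norm_sq, Complex.normSq_apply, Complex.mul_re, Complex.add_re,
      Complex.add_im, Complex.mul_im, Complex.ofReal_re, Complex.ofReal_im, Complex.conj_re,
      Complex.conj_im, map_add, map_mul]
    field_simp
    ring
  have hny : ∀ w : ℂ, w * conj w = ((‖w‖ ^ 2 : ℝ) : ℂ) := fun w => by
    rw [Complex.mul_conj, Complex.normSq_eq_norm_sq]
  simp only [density, hden, hny, absPow]
  rw [Real.rpow_neg hzpos.le, Real.rpow_neg (norm_nonneg _)]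
  push_cast
  ring

end

end ThreeCone

end

/-! ### The theorem. -/

theorem mainTheorem2 (α β γ : ℝ) (hα₀ : 0 < α) (hα₁ : α < 1) (hβ₀ : 0 < β) (hβ₁ : β < 1)
    (hγ₀ : 0 < γ) (hγ₁ : γ ≤ 1) (hsum : 2 < α + β + γ) :
    -- the density is smooth in a punctured neighbourhood of the origin, so that all the
    -- derivatives below are genuine
    (∀ᶠ z in 𝓝[≠] (0 : ℂ), ContDiffAt ℝ ∞ (ThreeCone.density α β γ) z) ∧
    ∃ (l : ℝ) (L : ℕ → ℕ → ℂ),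
      Tendsto (fun z : ℂ => ‖z‖ ^ α * ThreeCone.density α β γ z) (𝓝[≠] 0) (𝓝 l) ∧
      l = ThreeCone.delta α β γ * (1 - α) ∧
      (∀ m n : ℕ,
        Tendsto
          (fun z : ℂ => 1 / ((m ! : ℂ) * (n ! : ℂ)) *
            (((‖z‖ ^ α : ℝ) : ℂ) * (conj z) ^ m * z ^ n *
              (ThreeCone.dzbar^[m] (ThreeCone.dz^[n]
                (fun w : ℂ => (ThreeCone.density α β γ w : ℂ)))) z))
          (𝓝[≠] 0) (𝓝 (L m n))) ∧
      L 0 0 = l ∧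
      (∀ m n : ℕ,
        L m n = ((ThreeCone.binom (-(α / 2)) n * ThreeCone.binom (-(α / 2)) m * l : ℝ) : ℂ)) ∧
      (∀ m n : ℕ, L m n = L n m) := by
  -- `α + β > 2 - γ ≥ 1 ≥ γ` gives `a > 0`; `a < α` amounts to `β < α + γ`, and `b < α` to `β + γ <
  -- α + 2`.
  have ha : 0 < ThreeCone.parA α β γ := by rw [ThreeCone.parA]; linarith
  have hb : 0 < ThreeCone.parB α β γ := by rw [ThreeCone.parB]; linarith
  have haα : ThreeCone.parA α β γ < α := by rw [ThreeCone.parA]; linarith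
  have hbα : ThreeCone.parB α β γ < α := by rw [ThreeCone.parB]; linarith
  obtain ⟨g, hg, hdens⟩ := ThreeCone.exists_tame_density hα₁ hβ₁ ha hb haα hbα
  set l : ℝ := ThreeCone.delta α β γ * (1 - α) with hl
  -- The exponent `s = -α` makes the weight `|z|^α` and the factors `-α/2 - i`, whose products over
  -- `m! n!` are the binomials.
  have hlim := fun m n => ThreeCone.tendsto_iterate_absPow_mul (-α) m n hg hdens
  refine ⟨?_, l, fun m n =>
    ((ThreeCone.binom (-(α / 2)) n * ThreeCone.binom (-(α / 2)) m * l : ℝ) : ℂ), ?_, rfl, ?_, ?_,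
    fun _ _ => rfl, fun m n => by simp only [mul_comm]⟩
  · have h1 : ∀ᶠ z in 𝓝[≠] (0 : ℂ), ContDiffAt ℝ ∞ (fun z => ThreeCone.absPow (-α) z * g z) z := by
      filter_upwards [hg.contDiffAt, self_mem_nhdsWithin] with z h1 h2
      exact (ThreeCone.contDiffAt_absPow _ h2).mul h1
    filter_upwards [ThreeCone.contDiffAt_congr_punctured hdens.symm h1] with z hz
    exact (Complex.reCLM.contDiff.contDiffAt (n := ∞)).comp z hz
  · have h := (Complex.continuous_re.tendsto _).comp (hlim 0 0)
    simpa [ThreeCone.absPow, Function.comp_def, ← Complex.ofReal_mul] using h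
  · intro m n
    have h := (hlim m n).const_mul (1 / ((m ! : ℂ) * (n ! : ℂ)))
    simp only [ThreeCone.absPow, neg_neg] at h
    convert h using 2
    simp only [ThreeCone.binom, neg_div]
    push_cast
    ring
  · simp [ThreeCone.binom]
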